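/- **Rank one maps.** Let $p_n\ge 2$ ($n\ge 1$) be integers (cuts) and $a_{n,i}\ge 0$ ($1\le i\le p_n$) be integers (spacers) with $\sum_{n\ge1}\frac{1}{p_1\cdots p_n}\sum_{i=1}^{p_n}a_{n,i}<\infty$. Put $h_1=1$ and $h_{n+1}=p_nh_n+\sum_{i=1}^{p_n}a_{n,i}$. The first tower $\mathcal T_1$ is the unit interval. The tower $\mathcal T_n$, with base $B_n$, consists of $h_n$ levels, which are intervals of equal length; it is cut into $p_n$ columns $\mathcal T_{n,1},\dots,\mathcal T_{n,p_n}$ of equal width, $a_{n,i}$ new intervals of that width (spacers) are put over the $i$-th column, and the columns with their spacers are stacked, each on top of the preceding one, to form $\mathcal T_{n+1}$. The rank one map $G$ with these parameters sends each level of $\mathcal T_n$ other than the top one by translation onto the next level; it acts on $\mathcal T_\infty=\bigcup_n\mathcal T_n$ and preserves the normalized Lebesgue measure $\mu_G$ on $\mathcal T_\infty$. For $x,y$ lying in one level of some tower, $d_H(x,y)=1/h_m$, where $m$ is the largest number such that $x,y$ lie in one level of $\mathcal T_m$ ($d_H(x,y)=0$ if there is no largest such $m$). Objects belonging to $T$ or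 $S$ carry a superscript, and $d_1,d_2$ are the distances $d_H$ for $T$ and $S$. **Classes.** For $0<\gamma<\gamma'<1$ let $\mathcal C_{\gamma,\gamma'}$ be the set of rank one maps for which, for all large $n$, $h_n^{\gamma}\le p_n<h_n^{\gamma'}$, $a_{n,i}>a_{n,i-1}$ for $2\le i\le p_n$, and $a_{n,p_n}\le h_n^{\gamma'}$. An increasing sequence of positive integers $(b_n)$ is $(a_n)$-alternating with exponent $\delta$ if for all large $n$, with $m$ such that $b_m\le a_n<b_{m+1}$, one has $b_m^{1+\delta}<a_n$ and $a_n^{1+\delta}<b_{m+1}$. Let $\mathcal L^{\gamma,\gamma',\delta}$ be the set of pairs $(T,S)\in\mathcal C_{\gamma,\gamma'}\times\mathcal C_{\gamma,\gamma'}$ such that each of $(h^T_n)$, $(h^S_n)$ is alternating with exponent $\delta$ with respect to the other. **Good sets.** For $G\in\mathcal C_{\gamma,\gamma'}$ and $n\ge1$ let $$F_n^G=\Bigl(\bigcup_{i=\lfloor h_n/n^2\rfloor}^{h_n-\lfloor h_n/n^2\rfloor}G^i(B_n)\Bigr)\cap\Bigl(\bigcup_{h_n^{\gamma/4}\le i\le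 p_n-h_n^{\gamma/4}}\mathcal T_{n,i}\Bigr),\qquad F^G=\bigcap_{i\ge n_1}F_i^G,$$ where $n_1=n_1^G\ge1$ is such that $\mu_G(F^G)\ge 1-10^{-5}$; such an $n_1$ exists, and it may be chosen arbitrarily subject to this condition. **Names and matchings.** Let $\mathcal P_n$ be the product of the partition of $\mathcal T^T_\infty$ into the levels of $\mathcal T^T_n$ and the complement of $\mathcal T_n^T$, and the analogous partition of $\mathcal T^S_\infty$. The name $(\mathcal P_n)_0^N(x,y)$ is the word $x_0\dots x_{N-1}$ in which $x_i$ is the atom of $\mathcal P_n$ containing $(T^ix,S^iy)$. A matching of two words $(u_i)_{0\le i<N}$ and $(v_j)_{0\le j<N}$ is a pair of strictly increasing sequences $\theta=(i_s,j_s)_{s=1}^r$ with $u_{i_s}=v_{j_s}$ for all $s$. For a matching $\theta$ of $(\mathcal P_n)_0^N(x,y)$ and $(\mathcal P_n)_0^N(x',y')$ let $A^k_\theta((x,y),(x',y'))$ be the set of those $s\in\{1,\dots,r\}$ for which $(T^{i_s}x,S^{i_s}y)$ and $(T^{j_s}x',S^{j_s}y')$ both lie in $(F^T\cap\mathcal T^T_n)\times(F^S\cap\mathcal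 T^S_n)$ and $$2^{-k-1}\le\max\bigl(d_1(T^{i_s}x,T^{j_s}x'),\,d_2(S^{i_s}y,S^{j_s}y')\bigr)<2^{-k}.$$ **Proposition.** Let $0<\delta<\gamma<\gamma'<1$ and $(T,S)\in\mathcal L^{\gamma,\gamma',\delta}$. There exist $n_0\ge100$, $N_0\in\mathbb N$ and measurable $B\subset\mathcal T^T_\infty$, $C\subset\mathcal T^S_\infty$ with $(\mu_T\times\mu_S)(B\times C)\ge 99/100$, and for $x\in B$, $y\in C$ measurable sets $D_x\subset\mathcal T^T_\infty$, $D_y\subset\mathcal T^S_\infty$ with $(\mu_T\times\mu_S)(D_x\times D_y)\ge99/100$, such that for all $(x,y)\in B\times C$, $(x',y')\in D_x\times D_y$ and $N\ge N_0$: (P1) for each $(z,w)\in\{(x,y),(x',y')\}$, $$\bigl|\{i\in[0,N]: (T^iz,S^iw)\in(F^T\cap\mathcal T^T_{n_0})\times(F^S\cap\mathcal T^S_{n_0})\}\bigr|\ge\tfrac9{10}N;$$ (P2) for every integer $k\ge1$ and every matching $\theta$ of $(\mathcal P_{n_0})_0^N(x,y)$ and $(\mathcal P_{n_0})_0^N(x',y')$,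 $$\bigl|A^k_\theta((x,y),(x',y'))\bigr|\le\frac N{k^2}.$$ -/

import Mathlib

open MeasureTheory Set

/-- Parameters of a rank one system: the cuts `p n` (`n ≥ 1`) and the numbers of spacers `a n i`
(`n ≥ 1`, `1 ≤ i ≤ p n`), with `p n > 1` and finite total measure of the spacers.
The values of `p` and `a` at other indices are never used. -/
structure RankOne where
  p : ℕ → ℕ
  a : ℕ → ℕ → ℕ
  one_lt_p : ∀ n, 1 ≤ n → 1 < p n
  summable_spacers :
    Summable fun n : ℕ =>
      (1 / ∏ k ∈ Finset.Icc 1 (n + 1), (p k : ℝ)) *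
        ∑ i ∈ Finset.Icc 1 (p (n + 1)), (a (n + 1) i : ℝ)

namespace RankOne

/-- Heights: `h 1 = 1`, `h (n+1) = p n * h n + ∑_{i=1}^{p n} a n i` for `n ≥ 1`
(the value `h 0 = 1` is a dummy). -/
def h (G : RankOne) : ℕ → ℕ
  | 0 => 1
  | 1 => 1
  | n + 2 => G.p (n + 1) * G.h (n + 1) + ∑ i ∈ Finset.Icc 1 (G.p (n + 1)), G.a (n + 1) i

/-- The width `1 / ∏_{k=1}^{n-1} p k` of the levels of the `n`-th tower. -/
noncomputable def width (G : RankOne) (n : ℕ) : ℝ := 1 / ∏ k ∈ Finset.Ico 1 n, (G.p k : ℝ)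

/-- The number of spacers put at stage `n` over the columns `1, …, i - 1`. -/
def spacersBefore (G : RankOne) (n i : ℕ) : ℕ := ∑ l ∈ Finset.Ico 1 i, G.a n l

/-- The number of levels of the `(n+1)`-st tower lying below the `i`-th column (`1 ≤ i ≤ p n`)
of the `n`-th tower: all previous columns, with their spacers, are stacked below it. -/
def start (G : RankOne) (n i : ℕ) : ℕ := (i - 1) * G.h n + G.spacersBefore n i

/-- The index `i ∈ {1, …, p n}` of the column of the `n`-th tower which, together with the spacers
over it, contains the level number `k` of the `(n+1)`-st tower. -/
def colIndex (G : RankOne) (n k : ℕ) : ℕ := Nat.findGreatest (fun i => G.start n i ≤ k) (G.p n)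

/-- Left endpoint of the level number `k` (`0 ≤ k < h n`, counted from the base) of the `n`-th
tower. The first tower is the single interval `[0, 1)`. The level number `k` of the `(n+1)`-st tower
is either the part of a level of the `n`-th tower in its column `i`, or a spacer over the column
`i`. The `n`-th tower occupies `[0, h n * width n)`, and the spacers of stage `n` are placed, in the
order in which they are stacked, on the consecutive intervals of length `width (n+1)` to the right
of it. -/
noncomputable def left (G : RankOne) : ℕ → ℕ → ℝ
  | 0, _ => 0
  | 1, _ => 0
  | n + 2, k =>
    let i := G.colIndex (n + 1) k
    let r := k - G.start (n + 1) i
    if r < G.h (n + 1) then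
      G.left (n + 1) r + ((i : ℝ) - 1) * G.width (n + 2)
    else
      G.h (n + 1) * G.width (n + 1)
        + ((G.spacersBefore (n + 1) i + (r - G.h (n + 1)) : ℕ) : ℝ) * G.width (n + 2)

/-- The level number `j` (`0 ≤ j < h n`) of the `n`-th tower. -/
def level (G : RankOne) (n j : ℕ) : Set ℝ := Ico (G.left n j) (G.left n j + G.width n)

/-- The base of the `n`-th tower. -/
def base (G : RankOne) (n : ℕ) : Set ℝ := G.level n 0

/-- The `n`-th tower. -/
def tower (G : RankOne) (n : ℕ) : Set ℝ := ⋃ j ∈ Finset.range (G.h n), G.level n j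

/-- The column of the `n`-th tower over the `i`-th cut, `1 ≤ i ≤ p n`. -/
def column (G : RankOne) (n i : ℕ) : Set ℝ :=
  ⋃ j ∈ Finset.range (G.h n),
    Ico (G.left n j + ((i : ℝ) - 1) * G.width (n + 1)) (G.left n j + (i : ℝ) * G.width (n + 1))

/-- The phase space, the union of all towers. -/
def space (G : RankOne) : Set ℝ := ⋃ n ∈ Ici 1, G.tower n

open Classical in
/-- The rank one map: if `x` lies in a level `j` of an `n`-th tower that is not its top level, then
`x` is moved by translation to level `j + 1`; see `map_eq` for the independence of the choice
of the tower. With half-open levels every point of the phase space lies in such a level. -/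
noncomputable def map (G : RankOne) (x : ℝ) : ℝ :=
  if hx : ∃ q : ℕ × ℕ, 1 ≤ q.1 ∧ q.2 + 1 < G.h q.1 ∧ x ∈ G.level q.1 q.2 then
    x - G.left hx.choose.1 hx.choose.2 + G.left hx.choose.1 (hx.choose.2 + 1)
  else x

theorem width_pos (G : RankOne) (n : ℕ) : 0 < G.width n := by
  unfold width
  refine one_div_pos.2 (Finset.prod_pos fun k hk => ?_)
  have := G.one_lt_p k (Finset.mem_Ico.1 hk).1
  exact_mod_cast (by omega : 0 < G.p k)

theorem width_succ (G : RankOne) {n : ℕ} (hn : 1 ≤ n) :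
    G.width n = G.p n * G.width (n + 1) := by
  unfold width
  have h0 : (0 : ℝ) < ∏ k ∈ Finset.Ico 1 n, (G.p k : ℝ) := Finset.prod_pos fun k hk => by
    have := G.one_lt_p k (Finset.mem_Ico.1 hk).1
    exact_mod_cast (by omega : 0 < G.p k)
  have h1 : (0 : ℝ) < G.p n := by
    have := G.one_lt_p n hn
    exact_mod_cast (by omega : 0 < G.p n)
  rw [Finset.prod_Ico_succ_top hn]
  field_simp

theorem start_succ (G : RankOne) (n : ℕ) {i : ℕ} (hi : 1 ≤ i) :
    G.start n (i + 1) = G.start n i + (G.h n + G.a n i) := by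
  obtain ⟨i, rfl⟩ : ∃ j, i = j + 1 := ⟨i - 1, by omega⟩
  simp only [start, spacersBefore]
  rw [Finset.sum_Ico_succ_top (by omega)]
  simp only [Nat.add_sub_cancel]
  ring

theorem start_mono (G : RankOne) (n : ℕ) : Monotone (G.start n) := by
  refine monotone_nat_of_le_succ fun i => ?_
  rcases Nat.eq_zero_or_pos i with rfl | hi
  · simp [start, spacersBefore]
  · rw [G.start_succ n hi]; omega

theorem start_one (G : RankOne) (n : ℕ) : G.start n 1 = 0 := by simp [start, spacersBefore]

theorem start_top (G : RankOne) {n : ℕ} (hn : 1 ≤ n) : G.start n (G.p n + 1) = G.h (n + 1) := by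
  obtain ⟨n, rfl⟩ : ∃ j, n = j + 1 := ⟨n - 1, by omega⟩
  simp only [start, spacersBefore, h, Nat.add_sub_cancel]
  rfl

theorem colIndex_start_add (G : RankOne) {n i r : ℕ} (hi : 1 ≤ i) (hip : i ≤ G.p n)
    (hr : r < G.h n + G.a n i) : G.colIndex n (G.start n i + r) = i := by
  unfold colIndex
  rw [Nat.findGreatest_eq_iff]
  refine ⟨hip, fun _ => by omega, fun {m} hm _ => ?_⟩
  have h1 := G.start_mono n (show i + 1 ≤ m by omega)
  rw [G.start_succ n hi] at h1
  omega

/-- Every level of the next tower is over exactly one column. -/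
theorem exists_start_add (G : RankOne) {n k : ℕ} (hn : 1 ≤ n) (hk : k < G.h (n + 1)) :
    ∃ i r, 1 ≤ i ∧ i ≤ G.p n ∧ r < G.h n + G.a n i ∧ k = G.start n i + r := by
  have hp := G.one_lt_p n hn
  have h1 : G.start n 1 ≤ k := by rw [start_one]; omega
  have hle : G.colIndex n k ≤ G.p n := Nat.findGreatest_le _
  have hge : 1 ≤ G.colIndex n k :=
    Nat.le_findGreatest (P := fun i => G.start n i ≤ k) (by omega) h1
  have hs : G.start n (G.colIndex n k) ≤ k :=
    Nat.findGreatest_spec (P := fun i => G.start n i ≤ k) (by omega : 1 ≤ G.p n) h1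
  refine ⟨G.colIndex n k, k - G.start n (G.colIndex n k), hge, hle, ?_, by omega⟩
  have h2 : k < G.start n (G.colIndex n k + 1) := by
    rcases hle.lt_or_eq with hlt | he
    · by_contra hc
      have := Nat.findGreatest_is_greatest (P := fun i => G.start n i ≤ k) (n := G.p n)
        (show G.colIndex n k < G.colIndex n k + 1 by omega) (by omega)
      exact this (by omega)
    · rw [he, G.start_top hn]; exact hk
  rw [G.start_succ n hge] at h2
  omega

/-- Cutting: a level in the `i`-th column of the next tower. -/
theorem left_start_add (G : RankOne) {n i r : ℕ} (hn : 1 ≤ n) (hi : 1 ≤ i) (hip : i ≤ G.p n)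
    (hr : r < G.h n) :
    G.left (n + 1) (G.start n i + r) = G.left n r + ((i : ℝ) - 1) * G.width (n + 1) := by
  obtain ⟨n, rfl⟩ : ∃ j, n = j + 1 := ⟨n - 1, by omega⟩
  simp only [left]
  rw [G.colIndex_start_add hi hip (by omega), Nat.add_sub_cancel_left, if_pos hr]

/-- Stacking: the `t`-th spacer over the `i`-th column. -/
theorem left_start_add_spacer (G : RankOne) {n i t : ℕ} (hn : 1 ≤ n) (hi : 1 ≤ i)
    (hip : i ≤ G.p n) (ht : t < G.a n i) :
    G.left (n + 1) (G.start n i + (G.h n + t)) =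
      G.h n * G.width n + ((G.spacersBefore n i + t : ℕ) : ℝ) * G.width (n + 1) := by
  obtain ⟨n, rfl⟩ : ∃ j, n = j + 1 := ⟨n - 1, by omega⟩
  simp only [left]
  rw [G.colIndex_start_add hi hip (by omega), Nat.add_sub_cancel_left, if_neg (by omega),
    Nat.add_sub_cancel_left]

theorem spacersBefore_mono (G : RankOne) (n : ℕ) : Monotone (G.spacersBefore n) := fun _ _ hij =>
  Finset.sum_le_sum_of_subset (Finset.Ico_subset_Ico_right hij)

theorem h_width_succ (G : RankOne) {n : ℕ} (hn : 1 ≤ n) :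
    (G.h (n + 1) : ℝ) * G.width (n + 1) =
      G.h n * G.width n + (G.spacersBefore n (G.p n + 1) : ℝ) * G.width (n + 1) := by
  rw [← G.start_top hn, start, G.width_succ hn]
  push_cast [Nat.add_sub_cancel]
  ring

theorem left_bounds (G : RankOne) {n : ℕ} (hn : 1 ≤ n) :
    ∀ j < G.h n, 0 ≤ G.left n j ∧ G.left n j + G.width n ≤ G.h n * G.width n := by
  induction n, hn using Nat.le_induction with
  | base => intro j _; simp [left, h]
  | succ n hn ih =>
    intro k hk
    obtain ⟨i, r, hi, hip, hr, rfl⟩ := G.exists_start_add hn hk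
    have hw := G.width_pos (n + 1)
    have hi' : (1 : ℝ) ≤ i := by exact_mod_cast hi
    have hip' : (i : ℝ) ≤ G.p n := by exact_mod_cast hip
    rw [G.h_width_succ hn]
    have hw0 := G.width_pos n
    by_cases hrh : r < G.h n
    · rw [G.left_start_add hn hi hip hrh]
      obtain ⟨h1, h2⟩ := ih r hrh
      have h3 : (0 : ℝ) ≤ (G.spacersBefore n (G.p n + 1) : ℝ) * G.width (n + 1) := by positivity
      have h4 : 0 ≤ ((i : ℝ) - 1) * G.width (n + 1) := mul_nonneg (by linarith) hw.le
      have h5 : (i : ℝ) * G.width (n + 1) ≤ G.width n := by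
        rw [G.width_succ hn]; exact mul_le_mul_of_nonneg_right hip' hw.le
      exact ⟨by linarith, by linarith⟩
    · obtain ⟨t, rfl⟩ : ∃ t, r = G.h n + t := ⟨r - G.h n, by omega⟩
      rw [G.left_start_add_spacer hn hi hip (by omega)]
      refine ⟨by positivity, ?_⟩
      have h1 : G.spacersBefore n i + t + 1 ≤ G.spacersBefore n (G.p n + 1) := by
        refine le_trans ?_ (G.spacersBefore_mono n (show i + 1 ≤ G.p n + 1 by omega))
        rw [spacersBefore, spacersBefore, Finset.sum_Ico_succ_top hi]
        omega
      have h2 : ((G.spacersBefore n i + t : ℕ) : ℝ) + 1 ≤ G.spacersBefore n (G.p n + 1) := by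
        exact_mod_cast h1
      nlinarith [mul_le_mul_of_nonneg_right h2 hw.le]

/-- The levels of a tower are pairwise disjoint. -/
theorem level_disjoint (G : RankOne) {n : ℕ} (hn : 1 ≤ n) : ∀ j < G.h n, ∀ j' < G.h n, ∀ x : ℝ,
    x ∈ G.level n j → x ∈ G.level n j' → j = j' := by
  induction n, hn using Nat.le_induction with
  | base => intro j hj j' hj'; simp only [h] at hj hj'; intros; omega
  | succ n hn ih =>
    have key : ∀ (x : ℝ) (u v : ℕ), ∀ c w : ℝ, 0 < w → x ∈ Ico (c + u * w) (c + u * w + w) →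
        x ∈ Ico (c + v * w) (c + v * w + w) → u = v := by
      intro x u v c w hw h1 h2
      have e1 : (u : ℝ) < v + 1 := by nlinarith [h1.1, h2.2]
      have e2 : (v : ℝ) < u + 1 := by nlinarith [h1.2, h2.1]
      have e1' : u < v + 1 := by exact_mod_cast e1
      have e2' : v < u + 1 := by exact_mod_cast e2
      omega
    have hw := G.width_pos (n + 1)
    have sub : ∀ i r, 1 ≤ i → i ≤ G.p n → r < G.h n → ∀ x ∈ G.level (n + 1) (G.start n i + r),
        x ∈ G.level n r := by
      intro i r hi hip hr x hx
      rw [level, G.left_start_add hn hi hip hr] at hx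
      have hi' : (1 : ℝ) ≤ i := by exact_mod_cast hi
      have hip' : (i : ℝ) ≤ G.p n := by exact_mod_cast hip
      have h4 : 0 ≤ ((i : ℝ) - 1) * G.width (n + 1) := mul_nonneg (by linarith) hw.le
      have h5 : (i : ℝ) * G.width (n + 1) ≤ G.width n := by
        rw [G.width_succ hn]; exact mul_le_mul_of_nonneg_right hip' hw.le
      exact ⟨by linarith [hx.1], by linarith [hx.2]⟩
    have spac : ∀ i t, 1 ≤ i → i ≤ G.p n → t < G.a n i →
        ∀ x ∈ G.level (n + 1) (G.start n i + (G.h n + t)), ∀ r < G.h n, x ∉ G.level n r := by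
      intro i t hi hip ht x hx r hr hxr
      rw [level, G.left_start_add_spacer hn hi hip ht] at hx
      have h3 : (0 : ℝ) ≤ ((G.spacersBefore n i + t : ℕ) : ℝ) * G.width (n + 1) := by positivity
      linarith [hx.1, hxr.2, (G.left_bounds hn r hr).2]
    intro k hk k' hk' x hx hx'
    obtain ⟨i, r, hi, hip, hr, rfl⟩ := G.exists_start_add hn hk
    obtain ⟨i', r', hi', hip', hr', rfl⟩ := G.exists_start_add hn hk'
    by_cases c : r < G.h n <;> by_cases c' : r' < G.h n
    · have e := ih r c r' c' x (sub i r hi hip c x hx) (sub i' r' hi' hip' c' x hx')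
      subst e
      rw [level, G.left_start_add hn hi hip c] at hx
      rw [level, G.left_start_add hn hi' hip' c] at hx'
      obtain ⟨u, rfl⟩ : ∃ u, i = u + 1 := ⟨i - 1, by omega⟩
      obtain ⟨v, rfl⟩ : ∃ v, i' = v + 1 := ⟨i' - 1, by omega⟩
      push_cast [add_sub_cancel_right] at hx hx'
      rw [key x u v _ _ hw hx hx']
    · obtain ⟨t, rfl⟩ : ∃ t, r' = G.h n + t := ⟨r' - G.h n, by omega⟩
      exact absurd (sub i r hi hip c x hx) (spac i' t hi' hip' (by omega) x hx' r c)
    · obtain ⟨t, rfl⟩ : ∃ t, r = G.h n + t := ⟨r - G.h n, by omega⟩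
      exact absurd (sub i' r' hi' hip' c' x hx') (spac i t hi hip (by omega) x hx r' c')
    · obtain ⟨t, rfl⟩ : ∃ t, r = G.h n + t := ⟨r - G.h n, by omega⟩
      obtain ⟨t', rfl⟩ : ∃ t, r' = G.h n + t := ⟨r' - G.h n, by omega⟩
      rw [level, G.left_start_add_spacer hn hi hip (by omega)] at hx
      rw [level, G.left_start_add_spacer hn hi' hip' (by omega)] at hx'
      have e := key x _ _ _ _ hw hx hx'
      have step : ∀ i i' t t', 1 ≤ i → i < i' → t < G.a n i →
          G.spacersBefore n i + t < G.spacersBefore n i' + t' := by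
        intro i i' t t' hi hii ht
        have h1 := G.spacersBefore_mono n (show i + 1 ≤ i' by omega)
        rw [spacersBefore, Finset.sum_Ico_succ_top hi] at h1
        rw [spacersBefore]
        omega
      rcases lt_trichotomy i i' with hl | rfl | hl
      · have := step i i' t t' hi hl (by omega); omega
      · omega
      · have := step i' i t' t hi' hl (by omega); omega

/-- A point of a level that is not the top level of its tower has the same property in the next
tower, with the same translation to the level above. -/
theorem exists_level_succ (G : RankOne) {n j : ℕ} (hn : 1 ≤ n) (hj : j + 1 < G.h n) {x : ℝ}
    (hx : x ∈ G.level n j) : ∃ k, k + 1 < G.h (n + 1) ∧ x ∈ G.level (n + 1) k ∧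
      G.left (n + 1) (k + 1) - G.left (n + 1) k = G.left n (j + 1) - G.left n j := by
  have hw := G.width_pos (n + 1)
  have hy : 0 ≤ (x - G.left n j) / G.width (n + 1) := div_nonneg (by linarith [hx.1]) hw.le
  have hy' : (x - G.left n j) / G.width (n + 1) < G.p n := by
    rw [div_lt_iff₀ hw, ← G.width_succ hn]; linarith [hx.2]
  obtain ⟨u, hu⟩ : ∃ u, u = ⌊(x - G.left n j) / G.width (n + 1)⌋₊ := ⟨_, rfl⟩
  have h1 : (u : ℝ) * G.width (n + 1) ≤ x - G.left n j := by
    rw [← le_div_iff₀ hw, hu]; exact Nat.floor_le hy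
  have h2 : x - G.left n j < ((u : ℝ) + 1) * G.width (n + 1) := by
    rw [← div_lt_iff₀ hw, hu]; exact Nat.lt_floor_add_one _
  have hup : u < G.p n := by rw [hu]; exact (Nat.floor_lt hy).2 hy'
  have l1 := G.left_start_add hn (i := u + 1) (by omega) (by omega) (show j < G.h n by omega)
  have l2 := G.left_start_add hn (i := u + 1) (by omega) (by omega) hj
  refine ⟨G.start n (u + 1) + j, ?_, ?_, ?_⟩
  · have h3 := G.start_mono n (show u + 1 + 1 ≤ G.p n + 1 by omega)
    rw [G.start_succ n (by omega), G.start_top hn] at h3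
    omega
  · rw [level, l1]
    push_cast
    constructor <;> linarith
  · rw [add_assoc, l2, l1]; ring

/-- The rank one map moves every level that is not a top level by translation to the level above. -/
theorem map_eq (G : RankOne) {n j : ℕ} (hn : 1 ≤ n) (hj : j + 1 < G.h n) {x : ℝ}
    (hx : x ∈ G.level n j) : G.map x = x - G.left n j + G.left n (j + 1) := by
  have up : ∀ d n j, 1 ≤ n → j + 1 < G.h n → x ∈ G.level n j →
      ∃ k, k + 1 < G.h (n + d) ∧ x ∈ G.level (n + d) k ∧
        G.left (n + d) (k + 1) - G.left (n + d) k = G.left n (j + 1) - G.left n j := by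
    intro d
    induction d with
    | zero => intro n j _ hj hx; exact ⟨j, hj, hx, rfl⟩
    | succ d ih =>
      intro n j hn hj hx
      obtain ⟨k, hk, hxk, e⟩ := ih n j hn hj hx
      obtain ⟨k', hk', hxk', e'⟩ := G.exists_level_succ (by omega) hk hxk
      exact ⟨k', hk', hxk', e'.trans e⟩
  have hex : ∃ q : ℕ × ℕ, 1 ≤ q.1 ∧ q.2 + 1 < G.h q.1 ∧ x ∈ G.level q.1 q.2 :=
    ⟨(n, j), hn, hj, hx⟩
  rw [map, dif_pos hex]
  obtain ⟨hm, hi, hxi⟩ := hex.choose_spec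
  obtain ⟨k, hk, hxk, e⟩ := up hex.choose.1 n j hn hj hx
  obtain ⟨k', hk', hxk', e'⟩ := up n hex.choose.1 hex.choose.2 hm hi hxi
  rw [add_comm hex.choose.1 n] at hk' hxk' e'
  have hkk := G.level_disjoint (by omega) k (by omega) k' (by omega) x hxk hxk'
  subst hkk
  linarith

/-- Normalized Lebesgue measure on the phase space. -/
noncomputable def μ (G : RankOne) : Measure ℝ := ProbabilityTheory.cond volume G.space

/-- `x` and `y` are in one level of the `m`-th tower. -/
def SameLevel (G : RankOne) (m : ℕ) (x y : ℝ) : Prop :=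
  ∃ j < G.h m, x ∈ G.level m j ∧ y ∈ G.level m j

open Classical in
/-- Horizontal distance of two points lying in one level of some tower: `1 / h m` for the largest
`m ≥ 1` such that they are in one level of the `m`-th tower, and `0` if there is no largest `m`
(then the points coincide). It is only used for points lying in one level of some tower. -/
noncomputable def dH (G : RankOne) (x y : ℝ) : ℝ :=
  if BddAbove {m : ℕ | 1 ≤ m ∧ G.SameLevel m x y} then
    1 / (G.h (sSup {m : ℕ | 1 ≤ m ∧ G.SameLevel m x y}) : ℝ)
  else 0

/-- The class `𝒞_{γ,γ'}`. -/
def MemC (γ γ' : ℝ) (G : RankOne) : Prop :=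
  ∃ n' : ℕ, 1 ≤ n' ∧ ∀ n ≥ n',
    (G.h n : ℝ) ^ γ ≤ G.p n ∧ (G.p n : ℝ) < (G.h n : ℝ) ^ γ' ∧
    (∀ i, 2 ≤ i → i ≤ G.p n → G.a n (i - 1) < G.a n i) ∧
    (G.a n (G.p n) : ℝ) ≤ (G.h n : ℝ) ^ γ'

/-- The set `F_n`: the `n`-th tower without its lowest and highest levels and without its first and
last columns. -/
noncomputable def Fset (G : RankOne) (γ : ℝ) (n : ℕ) : Set ℝ :=
  (⋃ i ∈ Finset.Icc (G.h n / n ^ 2) (G.h n - G.h n / n ^ 2), G.map^[i] '' G.base n) ∩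
  (⋃ i ∈ {i : ℕ | (G.h n : ℝ) ^ (γ / 4) ≤ i ∧ (i : ℝ) ≤ G.p n - (G.h n : ℝ) ^ (γ / 4)},
    G.column n i)

/-- The set `F = ⋂_{i ≥ n₁} F_i`. -/
noncomputable def F (G : RankOne) (γ : ℝ) (n₁ : ℕ) : Set ℝ := ⋂ i ∈ Ici n₁, G.Fset γ i

/-- `n₁ ≥ 1` is an admissible starting index for `F`: the measure of `F` is at least
`1 - 10⁻⁵`. -/
def Admissible (G : RankOne) (γ : ℝ) (n₁ : ℕ) : Prop :=
  1 ≤ n₁ ∧ 1 - (10 : ℝ) ^ (-5 : ℤ) ≤ G.μ.real (G.F γ n₁)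

open Classical in
/-- The atom containing `x` of the partition of the phase space into the levels of the `n`-th tower
and the complement of this tower: `some j` stands for the level `j` and `none` for the
complement. -/
noncomputable def atom (G : RankOne) (n : ℕ) (x : ℝ) : Option ℕ :=
  if hx : ∃ j, j < G.h n ∧ x ∈ G.level n j then some (Nat.find hx) else none

end RankOne

/-- `b` is `a`-alternating with exponent `δ` (sequences indexed by the positive integers). -/
def AlternatingWith (δ : ℝ) (b a : ℕ → ℕ) : Prop :=
  ∃ n₀ : ℕ, 1 ≤ n₀ ∧ ∀ n ≥ n₀, ∀ m, 1 ≤ m → b m ≤ a n → a n < b (m + 1) →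
    (b m : ℝ) ^ (1 + δ) < a n ∧ (a n : ℝ) ^ (1 + δ) < b (m + 1)

/-- The class `ℒ^{γ,γ',δ}`. -/
def MemL (γ γ' δ : ℝ) (T S : RankOne) : Prop :=
  T.MemC γ γ' ∧ S.MemC γ γ' ∧ AlternatingWith δ T.h S.h ∧ AlternatingWith δ S.h T.h

/-- The name `x_0 … x_{N-1}` of the point `z` under `T × S` with respect to the product partition
`𝒫_n` of the partitions into levels of the `n`-th towers and their complements. -/
noncomputable def pname (T S : RankOne) (n N : ℕ) (z : ℝ × ℝ) : Fin N → Option ℕ × Option ℕ :=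
  fun i => (T.atom n (T.map^[i] z.1), S.atom n (S.map^[i] z.2))

/-- A matching between two words of length `N`. -/
structure Matching {α : Type*} {N : ℕ} (A B : Fin N → α) where
  r : ℕ
  i : Fin r → Fin N
  j : Fin r → Fin N
  strictMono_i : StrictMono i
  strictMono_j : StrictMono j
  eq : ∀ s, A (i s) = B (j s)

/-- The good set `(F^T ∩ 𝒯_n^T) × (F^S ∩ 𝒯_n^S)`. -/
noncomputable def goodSet (T S : RankOne) (γ : ℝ) (nT nS n : ℕ) : Set (ℝ × ℝ) :=
  (T.F γ nT ∩ T.tower n) ×ˢ (S.F γ nS ∩ S.tower n)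

/-- The set `A_θ^k(z, z')` for a matching `θ` of the `𝒫_n`-names of `z` and `z'`. -/
def matchedAtScale (T S : RankOne) (γ : ℝ) (nT nS n : ℕ) {N : ℕ} (z z' : ℝ × ℝ)
    (θ : Matching (pname T S n N z) (pname T S n N z')) (k : ℕ) : Set (Fin θ.r) :=
  {s | (T.map^[θ.i s] z.1, S.map^[θ.i s] z.2) ∈ goodSet T S γ nT nS n ∧
    (T.map^[θ.j s] z'.1, S.map^[θ.j s] z'.2) ∈ goodSet T S γ nT nS n ∧
    (2 : ℝ) ^ (-(k : ℤ) - 1) ≤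
      max (T.dH (T.map^[θ.i s] z.1) (T.map^[θ.j s] z'.1))
        (S.dH (S.map^[θ.i s] z.2) (S.map^[θ.j s] z'.2)) ∧
    max (T.dH (T.map^[θ.i s] z.1) (T.map^[θ.j s] z'.1))
        (S.dH (S.map^[θ.i s] z.2) (S.map^[θ.j s] z'.2)) < (2 : ℝ) ^ (-(k : ℤ))}

/-! Fix `k` and split the matched times into those at which the `T`-distance dominates and those at
which the `S`-distance does. By symmetry it suffices to bound the first kind by `N / (2 k²)`. The
heights at least double, so a single `m` satisfies `2^k < h_m ≤ 2^(k+1)` (heights of `T`). At every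
such time the `T`-points share a level of tower `m` but not of tower `m + 1`. Let `H` be the first
height of `S` exceeding `h_m`, that of tower `n + 1`. Since the `S`-distance is at most `1 / h_m`,
the `S`-points share a level of tower `n + 1`. Alternation gives `h_m^(1+δ) < H`, so a window of
length `W = 8 k² h_m` is shorter than the margin `H / (n + 1)²` that the good set keeps from the top
of that tower.

Take two such matched times whose gaps `u` and `v` in the two orbits are less than `W`. Both
`S`-points climb inside tower `n + 1` from a common level to a common level, so `u = v`
(`eq_of_sameLevel`). The `T`-points then travel for the same time from one level of tower `m` to one
level, starting in different columns. Had they left their columns, they would have crossed the same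
number of columns, because the spacers met add up to less than `h_m`. But spacers increase strictly
with the column, so the two travel times would differ. Hence `u < h_m` (`column_eq_of_start_eq`,
`lt_h_of_sameLevel`).

So a pair of windows contains at most `h_m` matched times. Monotonicity of a matching leaves at most
`2 N / W + 1` pairs of windows (`card_le_of_windows`), for a total of `N / (4 k²) + h_m`. This
suffices when `N ≥ 4 k² h_m`. For smaller `N` there is no match at all: the sets of admissible `x'`
and `y'` are chosen so that the starting levels are farther apart than either orbit can climb
(`card_matched_le`, `card_matched_dominant_le`).

The excluded levels have measure `O(1/n²)` in tower `n`, hence small total measure over all late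
towers. (P1) comes from the maximal ergodic inequality, which controls all times at once. Thus both
properties hold from `N₀ = 0` on. -/

/-- The maximum of the Birkhoff sums of `f` of lengths `0, …, n`. -/
noncomputable def birkhoffMax {X : Type*} (T : X → X) (f : X → ℝ) : ℕ → X → ℝ
  | 0, _ => 0
  | n + 1, x => max 0 (f x + birkhoffMax T f n (T x))

/-! ### Maximal ergodic inequality and visit frequencies -/

section Maximal

variable {X : Type*} {T : X → X} {f : X → ℝ}

theorem birkhoffMax_nonneg (n : ℕ) (x : X) : 0 ≤ birkhoffMax T f n x := by
  cases n with
  | zero => exact le_rfl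
  | succ n => exact le_max_left _ _

theorem birkhoffMax_mono_succ (n : ℕ) : ∀ x : X, birkhoffMax T f n x ≤ birkhoffMax T f (n + 1) x := by
  induction n with
  | zero => intro x; exact birkhoffMax_nonneg _ _
  | succ n ih =>
    intro x
    exact max_le_max le_rfl (by linarith [ih (T x)])

theorem birkhoffSum_le_birkhoffMax (n : ℕ) : ∀ x : X, birkhoffSum T f n x ≤ birkhoffMax T f n x := by
  induction n with
  | zero => intro x; simp [birkhoffMax]
  | succ n ih =>
    intro x
    rw [birkhoffSum_succ']
    exact le_max_of_le_right (by linarith [ih (T x)])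

variable [MeasurableSpace X] {μ : Measure X}

theorem measurable_birkhoffMax (hT : Measurable T) (hf : Measurable f) (n : ℕ) :
    Measurable (birkhoffMax T f n) := by
  induction n with
  | zero => exact measurable_const
  | succ n ih => exact measurable_const.max (hf.add (ih.comp hT))

theorem integrable_birkhoffMax (hT : MeasurePreserving T μ μ) (hf : Integrable f μ) (n : ℕ) :
    Integrable (birkhoffMax T f n) μ := by
  induction n with
  | zero => exact integrable_zero _ _ _
  | succ n ih =>
    exact (integrable_zero X ℝ μ).sup (hf.add ((hT.integrable_comp ih.aestronglyMeasurable).2 ih))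

/-- The maximal ergodic inequality. -/
theorem setIntegral_birkhoffMax_pos_nonneg (hT : MeasurePreserving T μ μ) (hfm : Measurable f)
    (hf : Integrable f μ) (n : ℕ) :
    0 ≤ ∫ x in {x | 0 < birkhoffMax T f (n + 1) x}, f x ∂μ := by
  have hm := measurable_birkhoffMax hT.measurable hfm (n + 1)
  have hs : MeasurableSet {x | 0 < birkhoffMax T f (n + 1) x} := measurableSet_lt measurable_const hm
  rw [← integral_indicator hs]
  have i1 := integrable_birkhoffMax hT hf (n + 1)
  have i0 := integrable_birkhoffMax hT hf n
  have i0T : Integrable (birkhoffMax T f n ∘ T) μ :=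
    (hT.integrable_comp i0.aestronglyMeasurable).2 i0
  have e : ∫ x, birkhoffMax T f n (T x) ∂μ = ∫ x, birkhoffMax T f n x ∂μ := by
    have := integral_map (μ := μ) hT.measurable.aemeasurable (f := birkhoffMax T f n)
      (by rw [hT.map_eq]; exact i0.aestronglyMeasurable)
    rw [hT.map_eq] at this
    exact this.symm
  have h1 : ∫ x, birkhoffMax T f n x ∂μ ≤ ∫ x, birkhoffMax T f (n + 1) x ∂μ :=
    integral_mono i0 i1 (birkhoffMax_mono_succ n)
  -- Garsia's argument: where the maximum `M_{n+1}` is positive, the recursion reads `M_{n+1} - M_n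
  -- ∘ T = f`. Elsewhere `M_{n+1} = 0`, so this difference is at most `0`. Its integral is
  -- nonnegative by invariance and monotonicity in `n`.
  calc 0 ≤ ∫ x, birkhoffMax T f (n + 1) x ∂μ - ∫ x, birkhoffMax T f n (T x) ∂μ := by
        rw [e]; linarith
    _ = ∫ x, (birkhoffMax T f (n + 1) x - birkhoffMax T f n (T x)) ∂μ :=
        (integral_sub i1 i0T).symm
    _ ≤ _ := by
        refine integral_mono (i1.sub i0T) (hf.indicator hs) fun x => ?_
        by_cases hx : 0 < birkhoffMax T f (n + 1) x
        · rw [indicator_of_mem (by exact hx)]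
          have : birkhoffMax T f (n + 1) x = f x + birkhoffMax T f n (T x) := by
            rw [birkhoffMax] at hx ⊢
            exact max_eq_right (by
              by_contra hc
              rw [max_eq_left (by linarith)] at hx
              exact lt_irrefl _ hx)
          simp only [this]
          linarith
        · rw [indicator_of_notMem (by exact hx)]
          have h2 := birkhoffMax_nonneg (T := T) (f := f) n (T x)
          simp only [not_lt] at hx
          simp only [sub_nonpos]
          linarith

/-- Outside a set of measure at most `μ E / l`, the frequency of the visits to `E` is at most `l` up
to every time. -/
theorem exists_card_visits_le [IsProbabilityMeasure μ] (hT : MeasurePreserving T μ μ) {E : Set X}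
    (hE : MeasurableSet E) {l : ℝ} (hl : 0 < l) :
    ∃ A : Set X, MeasurableSet A ∧ μ.real Aᶜ ≤ μ.real E / l ∧ ∀ x ∈ A, ∀ n : ℕ,
      ({i : ℕ | i < n ∧ T^[i] x ∈ E}.ncard : ℝ) ≤ l * n := by
  -- A Birkhoff sum of this `f` is positive exactly when the visit frequency exceeds `l`. The
  -- exceptional set is where some maximum is positive, an increasing union to which the uniform
  -- bound passes.
  set f : X → ℝ := fun x => E.indicator (fun _ => (1 : ℝ)) x - l with hf
  have hfm : Measurable f := (measurable_const.indicator hE).sub measurable_const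
  have hfi : Integrable f μ :=
    ((integrable_const (1 : ℝ)).indicator hE).sub (integrable_const l)
  have hs : ∀ n, MeasurableSet {x | 0 < birkhoffMax T f n x} := fun n =>
    measurableSet_lt measurable_const (measurable_birkhoffMax hT.measurable hfm n)
  have hb : ∀ n, μ.real {x | 0 < birkhoffMax T f n x} ≤ μ.real E / l := by
    intro n
    have hn : μ.real {x | 0 < birkhoffMax T f n x} ≤ μ.real {x | 0 < birkhoffMax T f (n + 1) x} :=
      measureReal_mono fun x hx => lt_of_lt_of_le (by exact hx) (birkhoffMax_mono_succ n x)
    refine hn.trans ?_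
    have h := setIntegral_birkhoffMax_pos_nonneg hT hfm hfi n
    rw [integral_sub (((integrable_const (1 : ℝ)).indicator hE).integrableOn)
      (integrable_const l).integrableOn, setIntegral_indicator hE] at h
    simp only [setIntegral_const, smul_eq_mul, mul_one] at h
    rw [le_div_iff₀ hl]
    have := measureReal_mono (μ := μ)
      (inter_subset_right : {x | 0 < birkhoffMax T f (n + 1) x} ∩ E ⊆ E)
    linarith
  refine ⟨(⋃ n, {x | 0 < birkhoffMax T f n x})ᶜ, (MeasurableSet.iUnion hs).compl, ?_, ?_⟩
  · rw [compl_compl]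
    have hmono : Monotone fun n => {x | 0 < birkhoffMax T f n x} :=
      monotone_nat_of_le_succ fun n x hx => lt_of_lt_of_le (by exact hx) (birkhoffMax_mono_succ n x)
    have ht := tendsto_measure_iUnion_atTop (μ := μ) hmono
    have ht' := (ENNReal.tendsto_toReal (measure_ne_top _ _)).comp ht
    exact le_of_tendsto' ht' hb
  · intro x hx n
    simp only [mem_compl_iff, mem_iUnion, not_exists, mem_ofPred_eq, not_lt] at hx
    have h := (birkhoffSum_le_birkhoffMax n x).trans (hx n)
    rw [birkhoffSum] at h
    simp only [hf, Finset.sum_sub_distrib, Finset.sum_const, Finset.card_range, nsmul_eq_mul] at h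
    classical
    have e : {i : ℕ | i < n ∧ T^[i] x ∈ E} = ({i ∈ Finset.range n | T^[i] x ∈ E} : Finset ℕ) := by
      ext i
      simp
    rw [e, ncard_coe_finset, Finset.card_filter]
    push_cast
    simp only [indicator_apply] at h
    linarith

end Maximal

/-! ### Nested towers and invariance of the measure -/

namespace RankOne

variable (G : RankOne)

theorem h_succ {n : ℕ} (hn : 1 ≤ n) :
    G.h (n + 1) = G.p n * G.h n + ∑ i ∈ Finset.Icc 1 (G.p n), G.a n i := by
  obtain ⟨n, rfl⟩ : ∃ j, n = j + 1 := ⟨n - 1, by omega⟩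
  rfl

theorem p_mul_h_le {n : ℕ} (hn : 1 ≤ n) : G.p n * G.h n ≤ G.h (n + 1) := by
  rw [G.h_succ hn]; omega

theorem two_mul_h_le {n : ℕ} (hn : 1 ≤ n) : 2 * G.h n ≤ G.h (n + 1) :=
  (Nat.mul_le_mul_right _ (G.one_lt_p n hn)).trans (G.p_mul_h_le hn)

theorem two_pow_le_h (n : ℕ) : 2 ^ n ≤ G.h (n + 1) := by
  induction n with
  | zero => simp [h]
  | succ n ih =>
    have := G.two_mul_h_le (n := n + 1) (by omega)
    rw [pow_succ]; omega

theorem h_pos (n : ℕ) : 0 < G.h n := by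
  rcases n with _ | n
  · simp [h]
  · exact lt_of_lt_of_le (by positivity) (G.two_pow_le_h n)

theorem h_mono : Monotone G.h := by
  refine monotone_nat_of_le_succ fun n => ?_
  rcases Nat.eq_zero_or_pos n with rfl | hn
  · simp [h]
  · have := G.two_mul_h_le hn; omega

theorem lt_h_succ (n : ℕ) : n < G.h (n + 1) := Nat.lt_two_pow_self.trans_le (G.two_pow_le_h n)

theorem start_add_lt {n c r : ℕ} (hn : 1 ≤ n) (hc : 1 ≤ c) (hcp : c ≤ G.p n) (hr : r < G.h n) :
    G.start n c + r < G.h (n + 1) := by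
  have h1 := G.start_mono n (show c + 1 ≤ G.p n + 1 by omega)
  rw [G.start_succ n hc, G.start_top hn] at h1
  omega

theorem level_start_add_eq {n c r : ℕ} (hn : 1 ≤ n) (hc : 1 ≤ c) (hcp : c ≤ G.p n)
    (hr : r < G.h n) : G.level (n + 1) (G.start n c + r) =
      Ico (G.left n r + ((c : ℝ) - 1) * G.width (n + 1))
        (G.left n r + (c : ℝ) * G.width (n + 1)) := by
  rw [level, G.left_start_add hn hc hcp hr]
  congr 1; ring

theorem level_start_add_subset {n c r : ℕ} (hn : 1 ≤ n) (hc : 1 ≤ c) (hcp : c ≤ G.p n)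
    (hr : r < G.h n) : G.level (n + 1) (G.start n c + r) ⊆ G.level n r := by
  rw [G.level_start_add_eq hn hc hcp hr, level, G.width_succ hn]
  have hw := G.width_pos (n + 1)
  have hc' : (1 : ℝ) ≤ c := by exact_mod_cast hc
  have hcp' : (c : ℝ) ≤ G.p n := by exact_mod_cast hcp
  refine Ico_subset_Ico ?_ ?_
  · nlinarith
  · nlinarith

theorem exists_mem_level_start_add {n r : ℕ} (hn : 1 ≤ n) (hr : r < G.h n) {x : ℝ}
    (hx : x ∈ G.level n r) :
    ∃ c, 1 ≤ c ∧ c ≤ G.p n ∧ x ∈ G.level (n + 1) (G.start n c + r) := by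
  have hw := G.width_pos (n + 1)
  have hy : 0 ≤ (x - G.left n r) / G.width (n + 1) := div_nonneg (by linarith [hx.1]) hw.le
  have hy' : (x - G.left n r) / G.width (n + 1) < G.p n := by
    rw [div_lt_iff₀ hw, ← G.width_succ hn]; linarith [hx.2]
  obtain ⟨u, hu⟩ : ∃ u, u = ⌊(x - G.left n r) / G.width (n + 1)⌋₊ := ⟨_, rfl⟩
  have h1 : (u : ℝ) * G.width (n + 1) ≤ x - G.left n r := by
    rw [← le_div_iff₀ hw, hu]; exact Nat.floor_le hy
  have h2 : x - G.left n r < ((u : ℝ) + 1) * G.width (n + 1) := by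
    rw [← div_lt_iff₀ hw, hu]; exact Nat.lt_floor_add_one _
  have hup : u < G.p n := by rw [hu]; exact (Nat.floor_lt hy).2 hy'
  refine ⟨u + 1, by omega, by omega, ?_⟩
  rw [G.level_start_add_eq hn (by omega) (by omega) hr]
  push_cast
  constructor <;> linarith

theorem mem_tower_iff {n : ℕ} {x : ℝ} : x ∈ G.tower n ↔ ∃ j < G.h n, x ∈ G.level n j := by
  simp [tower]

theorem tower_subset_succ {n : ℕ} (hn : 1 ≤ n) : G.tower n ⊆ G.tower (n + 1) := by
  intro x hx
  obtain ⟨j, hj, hxj⟩ := G.mem_tower_iff.1 hx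
  obtain ⟨c, hc, hcp, hxc⟩ := G.exists_mem_level_start_add hn hj hxj
  exact G.mem_tower_iff.2 ⟨_, G.start_add_lt hn hc hcp hj, hxc⟩

theorem tower_mono {n m : ℕ} (hn : 1 ≤ n) (hnm : n ≤ m) : G.tower n ⊆ G.tower m := by
  induction m, hnm using Nat.le_induction with
  | base => exact Subset.rfl
  | succ m hm ih => exact ih.trans (G.tower_subset_succ (by omega))

theorem tower_subset_space {n : ℕ} (hn : 1 ≤ n) : G.tower n ⊆ G.space := fun _ hx =>
  mem_iUnion₂.2 ⟨n, hn, hx⟩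

theorem level_subset_tower {n j : ℕ} (hj : j < G.h n) : G.level n j ⊆ G.tower n := fun _ hx =>
  G.mem_tower_iff.2 ⟨j, hj, hx⟩

/-- A level of a later tower that meets tower `n` is contained in one of its levels. The hypothesis
`x ∈ G.tower n` rules out spacers added after stage `n`. -/
theorem sameLevel_of_le {n m : ℕ} (hn : 1 ≤ n) (hnm : n ≤ m) {x y : ℝ} (hx : x ∈ G.tower n)
    (h : G.SameLevel m x y) : G.SameLevel n x y := by
  induction m, hnm using Nat.le_induction with
  | base => exact h
  | succ m hm ih =>
    refine ih ?_
    obtain ⟨k, hk, hxk, hyk⟩ := h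
    obtain ⟨j, hj, hxj⟩ := G.mem_tower_iff.1 (G.tower_mono hn hm hx)
    obtain ⟨c, hc, hcp, hxc⟩ := G.exists_mem_level_start_add (by omega) hj hxj
    have e := G.level_disjoint (by omega) _ hk _ (G.start_add_lt (by omega) hc hcp hj) x hxk hxc
    subst e
    exact ⟨j, hj, hxj, G.level_start_add_subset (by omega) hc hcp hj hyk⟩

theorem map_mem_level {n j : ℕ} (hn : 1 ≤ n) (hj : j + 1 < G.h n) {x : ℝ}
    (hx : x ∈ G.level n j) : G.map x ∈ G.level n (j + 1) := by
  rw [G.map_eq hn hj hx]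
  exact ⟨by linarith [hx.1], by linarith [hx.2]⟩

theorem iterate_map_mem_level {n j : ℕ} (hn : 1 ≤ n) {x : ℝ} (hx : x ∈ G.level n j) :
    ∀ {i : ℕ}, j + i < G.h n → G.map^[i] x ∈ G.level n (j + i)
  | 0, _ => hx
  | i + 1, hi => by
    rw [Function.iterate_succ_apply']
    exact G.map_mem_level hn (by omega) (iterate_map_mem_level hn hx (i := i) (by omega))

theorem width_succ_eq_inv_prod (n : ℕ) :
    G.width (n + 1) = 1 / ∏ k ∈ Finset.Icc 1 n, (G.p k : ℝ) := by
  rw [width]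
  rfl

theorem width_le (n : ℕ) : G.width (n + 1) ≤ (1 / 2) ^ n := by
  induction n with
  | zero => simp [width]
  | succ n ih =>
    have h1 := G.width_succ (n := n + 1) (by omega)
    have h2 : (2 : ℝ) ≤ G.p (n + 1) := by exact_mod_cast G.one_lt_p (n + 1) (by omega)
    have h3 := G.width_pos (n + 2)
    rw [pow_succ]
    nlinarith

/-- Every point of the phase space lies in a level that is not the top level of its tower. -/
theorem exists_not_top {x : ℝ} (hx : x ∈ G.space) :
    ∃ n j, 1 ≤ n ∧ j + 1 < G.h n ∧ x ∈ G.level n j := by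
  by_contra! hcon
  obtain ⟨n, hn, hxn⟩ := mem_iUnion₂.1 hx
  have top : ∀ m, 1 ≤ m → x ∈ G.tower m → x ∈ G.level m (G.h m - 1) := by
    intro m hm hxm
    obtain ⟨j, hj, hxj⟩ := G.mem_tower_iff.1 hxm
    by_cases c : j + 1 < G.h m
    · exact absurd hxj (hcon m j hm c)
    · rwa [show G.h m - 1 = j by omega]
  -- A point that is always in the top level is always in the last column, so the right endpoint of
  -- its level never changes. The widths tend to `0`, which forces `x` up to that endpoint, and
  -- half-open levels exclude it.
  have key : ∀ d, x ∈ G.tower (n + d) ∧ G.left (n + d) (G.h (n + d) - 1) + G.width (n + d) =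
      G.left n (G.h n - 1) + G.width n := by
    intro d
    induction d with
    | zero => exact ⟨hxn, rfl⟩
    | succ d ih =>
      obtain ⟨hxd, e⟩ := ih
      have hm : 1 ≤ n + d := le_trans hn (by omega)
      have hlt : G.h (n + d) - 1 < G.h (n + d) := by have := G.h_pos (n + d); omega
      refine ⟨G.tower_subset_succ hm hxd, ?_⟩
      rw [← e]
      obtain ⟨c, hc, hcp, hxc⟩ := G.exists_mem_level_start_add hm hlt (top _ hm hxd)
      have hl := G.start_add_lt hm hc hcp hlt
      have e1 := G.level_disjoint (show 1 ≤ n + d + 1 by omega) _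
        (by have := G.h_pos (n + d + 1); omega) _ hl x
        (top (n + d + 1) (by omega) (G.tower_subset_succ hm hxd)) hxc
      have hcp' : c = G.p (n + d) := by
        by_contra hne
        have h1 := G.start_mono (n + d) (show c + 1 ≤ G.p (n + d) by omega)
        rw [G.start_succ _ hc] at h1
        have h2 := G.start_add_lt hm (c := G.p (n + d)) (by omega) le_rfl hlt
        omega
      rw [← add_assoc, e1, G.left_start_add hm hc hcp hlt, G.width_succ hm, hcp']
      ring
  obtain ⟨d, hd⟩ := exists_pow_lt_of_lt_one (sub_pos.2 (top n hn hxn).2)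
    (show (1 / 2 : ℝ) < 1 by norm_num)
  have h1 := top _ (show 1 ≤ n + (d + 1) from le_trans hn (by omega)) (key (d + 1)).1
  have h2 := (key (d + 1)).2
  have h3 := h1.1
  have h4 := G.width_le (n + d)
  have h5 : (1 / 2 : ℝ) ^ (n + d) ≤ (1 / 2) ^ d :=
    pow_le_pow_of_le_one (by norm_num) (by norm_num) (by omega)
  rw [← add_assoc] at h2 h3
  linarith

/-- The `n`-th tower without its top level. -/
def lowerTower (n : ℕ) : Set ℝ := ⋃ j ∈ Finset.range (G.h n - 1), G.level n j

theorem mem_lowerTower_iff {n : ℕ} {x : ℝ} :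
    x ∈ G.lowerTower n ↔ ∃ j, j + 1 < G.h n ∧ x ∈ G.level n j := by
  simp only [lowerTower, mem_iUnion, Finset.mem_range, exists_prop, Nat.lt_sub_iff_add_lt]

theorem lowerTower_subset_succ {n : ℕ} (hn : 1 ≤ n) : G.lowerTower n ⊆ G.lowerTower (n + 1) := by
  intro x hx
  obtain ⟨j, hj, hxj⟩ := G.mem_lowerTower_iff.1 hx
  obtain ⟨k, hk, hxk, -⟩ := G.exists_level_succ hn hj hxj
  exact G.mem_lowerTower_iff.2 ⟨k, hk, hxk⟩

theorem monotone_lowerTower_succ : Monotone fun n => G.lowerTower (n + 1) :=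
  monotone_nat_of_le_succ fun _ => G.lowerTower_subset_succ (by omega)

theorem monotone_tower_succ : Monotone fun n => G.tower (n + 1) :=
  monotone_nat_of_le_succ fun _ => G.tower_subset_succ (by omega)

theorem lowerTower_subset_tower (n : ℕ) : G.lowerTower n ⊆ G.tower n := by
  intro x hx
  obtain ⟨j, hj, hxj⟩ := G.mem_lowerTower_iff.1 hx
  exact G.mem_tower_iff.2 ⟨j, by omega, hxj⟩

theorem iUnion_lowerTower : ⋃ n, G.lowerTower (n + 1) = G.space := by
  refine Subset.antisymm (iUnion_subset fun n =>
    (G.lowerTower_subset_tower _).trans (G.tower_subset_space (by omega))) fun x hx => ?_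
  obtain ⟨n, j, hn, hj, hxj⟩ := G.exists_not_top hx
  obtain ⟨n, rfl⟩ : ∃ k, n = k + 1 := ⟨n - 1, by omega⟩
  exact mem_iUnion.2 ⟨n, G.mem_lowerTower_iff.2 ⟨j, hj, hxj⟩⟩

theorem iUnion_tower : ⋃ n, G.tower (n + 1) = G.space := by
  refine Subset.antisymm (iUnion_subset fun n => G.tower_subset_space (by omega)) ?_
  rw [← G.iUnion_lowerTower]
  exact iUnion_mono fun n => G.lowerTower_subset_tower _

theorem measurableSet_level (n j : ℕ) : MeasurableSet (G.level n j) := measurableSet_Ico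

theorem measurableSet_tower (n : ℕ) : MeasurableSet (G.tower n) :=
  Finset.measurableSet_biUnion _ fun _ _ => G.measurableSet_level _ _

theorem measurableSet_space : MeasurableSet G.space := by
  rw [← G.iUnion_tower]
  exact MeasurableSet.iUnion fun _ => G.measurableSet_tower _

theorem mapsTo_map : MapsTo G.map G.space G.space := by
  intro x hx
  obtain ⟨n, j, hn, hj, hxj⟩ := G.exists_not_top hx
  exact G.tower_subset_space hn (G.level_subset_tower hj (G.map_mem_level hn hj hxj))

theorem injOn_map : InjOn G.map G.space := by
  intro x hx y hy hxy
  rw [← G.iUnion_lowerTower] at hx hy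
  obtain ⟨n, hxn⟩ := mem_iUnion.1 hx
  obtain ⟨m, hym⟩ := mem_iUnion.1 hy
  obtain ⟨j, hj, hxj⟩ := G.mem_lowerTower_iff.1
    (G.monotone_lowerTower_succ (le_max_left n m) hxn)
  obtain ⟨k, hk, hyk⟩ := G.mem_lowerTower_iff.1
    (G.monotone_lowerTower_succ (le_max_right n m) hym)
  have h1 := G.map_mem_level (by omega) hj hxj
  have h2 := G.map_mem_level (by omega) hk hyk
  rw [← hxy] at h2
  have e := G.level_disjoint (by omega) _ hj _ hk _ h1 h2
  obtain rfl : j = k := by omega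
  rw [G.map_eq (by omega) hj hxj, G.map_eq (by omega) hk hyk] at hxy
  linarith

theorem map_of_notMem_space {x : ℝ} (hx : x ∉ G.space) : G.map x = x := by
  rw [map, dif_neg]
  rintro ⟨q, hq, hj, hxq⟩
  exact hx (G.tower_subset_space hq (G.level_subset_tower (by omega) hxq))

theorem measurable_map : Measurable G.map := by
  intro A hA
  have e : G.map ⁻¹' A = (A \ G.space) ∪ ⋃ n : ℕ, ⋃ j ∈ Finset.range (G.h (n + 1) - 1),
      (G.level (n + 1) j ∩
        (fun x => x - G.left (n + 1) j + G.left (n + 1) (j + 1)) ⁻¹' A) := by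
    ext x
    simp only [mem_preimage, mem_union, mem_sdiff, mem_iUnion, mem_inter_iff, Finset.mem_range,
      exists_prop, Nat.lt_sub_iff_add_lt]
    constructor
    · intro hx
      by_cases hs : x ∈ G.space
      · right
        obtain ⟨n, j, hn, hj, hxj⟩ := G.exists_not_top hs
        obtain ⟨n, rfl⟩ : ∃ k, n = k + 1 := ⟨n - 1, by omega⟩
        exact ⟨n, j, hj, hxj, by rwa [← G.map_eq hn hj hxj]⟩
      · left
        rw [G.map_of_notMem_space hs] at hx
        exact ⟨hx, hs⟩
    · rintro (⟨hx, hs⟩ | ⟨n, j, hj, hxj, hx⟩)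
      · rwa [G.map_of_notMem_space hs]
      · rwa [G.map_eq (by omega) hj hxj]
  rw [e]
  refine (hA.diff G.measurableSet_space).union (MeasurableSet.iUnion fun n =>
    Finset.measurableSet_biUnion _ fun j _ => (G.measurableSet_level _ _).inter ?_)
  exact ((measurable_id.sub_const _).add_const _) hA

theorem volume_level (n j : ℕ) : volume (G.level n j) = ENNReal.ofReal (G.width n) := by
  rw [level, Real.volume_Ico]; congr 1; ring

theorem pairwiseDisjoint_level {n : ℕ} (hn : 1 ≤ n) {s : Finset ℕ}
    (hs : s ⊆ Finset.range (G.h n)) : (s : Set ℕ).PairwiseDisjoint (G.level n) := by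
  intro j hj k hk hjk
  refine Set.disjoint_left.2 fun x hx hx' => hjk ?_
  exact G.level_disjoint hn j (Finset.mem_range.1 (hs hj)) k (Finset.mem_range.1 (hs hk)) x hx hx'

theorem volume_tower {n : ℕ} (hn : 1 ≤ n) :
    volume (G.tower n) = ENNReal.ofReal (G.h n * G.width n) := by
  rw [tower, measure_biUnion_finset (G.pairwiseDisjoint_level hn Finset.Subset.rfl)
    fun _ _ => G.measurableSet_level _ _]
  simp only [G.volume_level, Finset.sum_const, Finset.card_range, nsmul_eq_mul]
  rw [ENNReal.ofReal_mul (by positivity), ENNReal.ofReal_natCast]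

theorem h_mul_width_eq (n : ℕ) : (G.h (n + 1) : ℝ) * G.width (n + 1) =
    1 + ∑ k ∈ Finset.range n, (1 / ∏ i ∈ Finset.Icc 1 (k + 1), (G.p i : ℝ)) *
        ∑ i ∈ Finset.Icc 1 (G.p (k + 1)), (G.a (k + 1) i : ℝ) := by
  induction n with
  | zero => simp [h, width]
  | succ n ih =>
    rw [G.h_width_succ (by omega), ih, Finset.sum_range_succ, ← G.width_succ_eq_inv_prod,
      spacersBefore]
    push_cast
    rw [show Finset.Ico 1 (G.p (n + 1) + 1) = Finset.Icc 1 (G.p (n + 1)) from rfl]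
    ring

theorem volume_space_lt_top : volume G.space < ⊤ := by
  rw [← G.iUnion_tower, G.monotone_tower_succ.measure_iUnion]
  refine lt_of_le_of_lt (b := ENNReal.ofReal
    (1 + ∑' k, (1 / ∏ i ∈ Finset.Icc 1 (k + 1), (G.p i : ℝ)) *
        ∑ i ∈ Finset.Icc 1 (G.p (k + 1)), (G.a (k + 1) i : ℝ)))
    (iSup_le fun n => ?_) ENNReal.ofReal_lt_top
  · rw [G.volume_tower (by omega), G.h_mul_width_eq]
    refine ENNReal.ofReal_le_ofReal (add_le_add_right ?_ 1)
    exact G.summable_spacers.sum_le_tsum _ fun i _ => by positivity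

theorem volume_space_ne_zero : volume G.space ≠ 0 := by
  refine (lt_of_lt_of_le ?_ (measure_mono (G.tower_subset_space le_rfl))).ne'
  rw [G.volume_tower le_rfl, ENNReal.ofReal_pos]
  have := G.width_pos 1
  have := G.h_pos 1
  positivity

instance isProbabilityMeasure_μ : IsProbabilityMeasure G.μ :=
  ProbabilityTheory.cond_isProbabilityMeasure_of_finite G.volume_space_ne_zero
    G.volume_space_lt_top.ne

theorem μ_apply (s : Set ℝ) : G.μ s = (volume G.space)⁻¹ * volume (G.space ∩ s) :=
  ProbabilityTheory.cond_apply G.measurableSet_space _ _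

/-- On each level of a lower tower the map is a translation onto the next level, so equality holds
piece by piece. The lower towers exhaust the space, and continuity from below finishes. -/
theorem volume_map_preimage_inter_space_le {A : Set ℝ} (hA : MeasurableSet A) :
    volume (G.space ∩ G.map ⁻¹' A) ≤ volume (G.space ∩ A) := by
  have e : G.space ∩ G.map ⁻¹' A = ⋃ n, G.lowerTower (n + 1) ∩ G.map ⁻¹' A := by
    rw [← G.iUnion_lowerTower, iUnion_inter]
  rw [e, Monotone.measure_iUnion fun a b hab =>
    inter_subset_inter_left _ (G.monotone_lowerTower_succ hab)]
  refine iSup_le fun n => ?_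
  change volume (G.lowerTower (n + 1) ∩ G.map ⁻¹' A) ≤ _
  have hn : 1 ≤ n + 1 := by omega
  generalize n + 1 = n at hn
  have hlt : ∀ j ∈ Finset.range (G.h n - 1), j + 1 < G.h n := fun j hj => by
    have := Finset.mem_range.1 hj; omega
  have step : ∀ j ∈ Finset.range (G.h n - 1),
      volume (G.level n j ∩ G.map ⁻¹' A) = volume (G.level n (j + 1) ∩ A) := by
    intro j hj
    have e2 : G.level n j ∩ G.map ⁻¹' A =
        (fun x => x + (G.left n (j + 1) - G.left n j)) ⁻¹' (G.level n (j + 1) ∩ A) := by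
      ext x
      have hmem : x ∈ G.level n j ↔ x + (G.left n (j + 1) - G.left n j) ∈ G.level n (j + 1) := by
        simp only [level, mem_Ico]
        constructor <;> rintro ⟨h1, h2⟩ <;> constructor <;> linarith
      simp only [mem_inter_iff, mem_preimage, ← hmem]
      refine and_congr_right fun hx => ?_
      rw [G.map_eq hn (hlt j hj) hx]
      ring_nf
    rw [e2, measure_preimage_add_right]
  rw [lowerTower, iUnion₂_inter, measure_biUnion_finset, Finset.sum_congr rfl step,
    ← measure_biUnion_finset]
  · refine measure_mono (iUnion₂_subset fun j hj => inter_subset_inter_left _ ?_)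
    exact (G.level_subset_tower (hlt j hj)).trans (G.tower_subset_space hn)
  · intro j hj k hk hjk
    refine Set.disjoint_left.2 fun x hx hx' => hjk ?_
    have := G.level_disjoint hn _ (hlt j hj) _ (hlt k hk) x hx.1 hx'.1
    omega
  · exact fun j _ => (G.measurableSet_level _ _).inter hA
  · intro j hj k hk hjk
    refine Set.disjoint_left.2 fun x hx hx' => hjk ?_
    have h1 := hlt j hj
    have h2 := hlt k hk
    exact G.level_disjoint hn _ (by omega) _ (by omega) x hx.1 hx'.1
  · exact fun j _ => (G.measurableSet_level _ _).inter (G.measurable_map hA)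

/-- For a probability measure, `μ (G⁻¹ A) ≤ μ A` for all `A` suffices: applied to the complement it
gives the reverse inequality. -/
theorem measurePreserving_map : MeasurePreserving G.map G.μ G.μ := by
  have le : ∀ A, MeasurableSet A → G.μ (G.map ⁻¹' A) ≤ G.μ A := fun A hA => by
    rw [G.μ_apply, G.μ_apply]
    exact mul_le_mul_right (G.volume_map_preimage_inter_space_le hA) _
  refine ⟨G.measurable_map, Measure.ext fun A hA => ?_⟩
  rw [Measure.map_apply G.measurable_map hA]
  refine le_antisymm (le A hA) ?_
  have h1 := le _ hA.compl
  rw [preimage_compl, prob_compl_eq_one_sub hA, prob_compl_eq_one_sub (G.measurable_map hA)] at h1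
  exact (ENNReal.sub_le_sub_iff_left prob_le_one ENNReal.one_ne_top).1 h1

theorem μ_real_compl_space : G.μ.real G.spaceᶜ = 0 := by
  rw [measureReal_def, G.μ_apply]
  simp

theorem μ_real_level_le {n j : ℕ} (hn : 1 ≤ n) (hj : j < G.h n) :
    G.μ.real (G.level n j) ≤ 1 / G.h n := by
  have hv : ∀ k ∈ Finset.range (G.h n), G.μ.real (G.level n k) = G.μ.real (G.level n j) := by
    intro k hk
    rw [measureReal_def, measureReal_def, G.μ_apply, G.μ_apply,
      inter_eq_self_of_subset_right ((G.level_subset_tower (Finset.mem_range.1 hk)).trans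
        (G.tower_subset_space hn)),
      inter_eq_self_of_subset_right ((G.level_subset_tower hj).trans
        (G.tower_subset_space hn)), G.volume_level, G.volume_level]
  have h1 : G.μ.real (G.tower n) ≤ 1 := measureReal_le_one
  rw [tower, measureReal_biUnion_finset (G.pairwiseDisjoint_level hn Finset.Subset.rfl)
    fun _ _ => G.measurableSet_level _ _, Finset.sum_congr rfl hv, Finset.sum_const,
    Finset.card_range, nsmul_eq_mul] at h1
  have := G.h_pos n
  rw [le_div_iff₀ (by positivity)]
  linarith

theorem μ_real_biUnion_level_le {n : ℕ} (hn : 1 ≤ n) {s : Finset ℕ}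
    (hs : s ⊆ Finset.range (G.h n)) :
    G.μ.real (⋃ j ∈ s, G.level n j) ≤ s.card / G.h n := by
  refine (measureReal_biUnion_finset_le _ _).trans ?_
  refine (Finset.sum_le_card_nsmul _ _ _ fun j hj =>
    G.μ_real_level_le hn (Finset.mem_range.1 (hs hj))).trans ?_
  rw [nsmul_eq_mul, mul_one_div]

theorem tendsto_μ_real_compl_tower :
    Filter.Tendsto (fun n => G.μ.real (G.tower n)ᶜ) Filter.atTop (nhds 0) := by
  rw [← Filter.tendsto_add_atTop_iff_nat 1]
  have h1 := tendsto_measure_iInter_atTop (μ := G.μ) (s := fun n => (G.tower (n + 1))ᶜ)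
    (fun n => (G.measurableSet_tower _).compl.nullMeasurableSet)
    (fun a b hab => compl_subset_compl.2 (G.monotone_tower_succ hab))
    ⟨0, measure_ne_top _ _⟩
  rw [← compl_iUnion, G.iUnion_tower] at h1
  have h2 := (ENNReal.tendsto_toReal (measure_ne_top _ _)).comp h1
  have h3 := G.μ_real_compl_space
  rw [measureReal_def] at h3
  rw [h3] at h2
  exact h2

end RankOne

/-! ### Small sets to avoid, and the good sets `F` -/

/-- The threshold depends only on the bounds `c` and not on the sets. This makes it uniform in `x`
for the sets `nearLevels n x`. -/
theorem exists_measureReal_biUnion_Ici_le {X : Type*} [MeasurableSpace X] (μ : Measure X)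
    [IsFiniteMeasure μ] {c : ℕ → ℝ} (hc : Summable c) {ε : ℝ} (hε : 0 < ε) :
    ∃ N, ∀ M ≥ N, ∀ U : ℕ → Set X, (∀ n ≥ M, μ.real (U n) ≤ c n) →
      μ.real (⋃ n ∈ Ici M, U n) ≤ ε := by
  have ht := tendsto_sum_nat_add c
  obtain ⟨N, hN⟩ := Filter.eventually_atTop.1 (ht.eventually (gt_mem_nhds hε))
  refine ⟨N, fun M hM U hU => ?_⟩
  have e : ⋃ n ∈ Ici M, U n = ⋃ k, U (k + M) := by
    ext x
    simp only [mem_iUnion, mem_Ici, exists_prop]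
    exact ⟨fun ⟨n, hn, hx⟩ => ⟨n - M, by rwa [Nat.sub_add_cancel hn]⟩,
      fun ⟨k, hk⟩ => ⟨k + M, by omega, hk⟩⟩
  have hc0 : ∀ k, 0 ≤ c (k + M) := fun k => measureReal_nonneg.trans (hU (k + M) (by omega))
  have hs : Summable fun k => c (k + M) := (summable_nat_add_iff M).2 hc
  rw [e, measureReal_def]
  refine ENNReal.toReal_le_of_le_ofReal hε.le ((measure_iUnion_le _).trans ?_)
  calc ∑' k, μ (U (k + M)) ≤ ∑' k, ENNReal.ofReal (c (k + M)) := by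
        refine ENNReal.tsum_le_tsum fun k => ?_
        rw [← ofReal_measureReal]
        exact ENNReal.ofReal_le_ofReal (hU (k + M) (by omega))
    _ = ENNReal.ofReal (∑' k, c (k + M)) := (ENNReal.ofReal_tsum_of_nonneg hc0 hs).symm
    _ ≤ ENNReal.ofReal ε := ENNReal.ofReal_le_ofReal (hN M hM).le

namespace RankOne

variable (G : RankOne)

/-- The union of the lowest and highest levels of the `n`-th tower. -/
def edgeLevels (n : ℕ) : Set ℝ :=
  ⋃ r ∈ {r ∈ Finset.range (G.h n) | r < G.h n / n ^ 2 ∨ G.h n - G.h n / n ^ 2 < r}, G.level n r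

open Classical in
/-- The union of the levels of the `n`-th tower that are close to the level of `x`. -/
noncomputable def nearLevels (n : ℕ) (x : ℝ) : Set ℝ :=
  ⋃ r ∈ {r ∈ Finset.range (G.h n) | ∃ l < G.h n, x ∈ G.level n l ∧
    r < l + G.h n / n ^ 2 ∧ l < r + G.h n / n ^ 2}, G.level n r

open Classical in
/-- The part of the `n`-th tower in its first and last columns. -/
noncomputable def edgeColumns (γ : ℝ) (n : ℕ) : Set ℝ :=
  ⋃ c ∈ (Finset.Icc 1 (G.p n)).filter fun c : ℕ => (c : ℝ) < (G.h n : ℝ) ^ (γ / 4) ∨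
    (G.p n : ℝ) - (G.h n : ℝ) ^ (γ / 4) < c, ⋃ r ∈ Finset.range (G.h n),
      G.level (n + 1) (G.start n c + r)

theorem measurableSet_edgeLevels (n : ℕ) : MeasurableSet (G.edgeLevels n) :=
  Finset.measurableSet_biUnion _ fun _ _ => G.measurableSet_level _ _

theorem measurableSet_nearLevels (n : ℕ) (x : ℝ) : MeasurableSet (G.nearLevels n x) :=
  Finset.measurableSet_biUnion _ fun _ _ => G.measurableSet_level _ _

theorem card_div_h_le {n c : ℕ} (hc : c ≤ 2 * (G.h n / n ^ 2)) :
    (c : ℝ) / G.h n ≤ 2 * (1 / (n : ℝ) ^ 2) := by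
  have hh : (0 : ℝ) < G.h n := by exact_mod_cast G.h_pos n
  have h1 : ((G.h n / n ^ 2 : ℕ) : ℝ) ≤ (G.h n : ℝ) / (n : ℝ) ^ 2 := by
    exact_mod_cast (Nat.cast_div_le (α := ℝ) (m := G.h n) (n := n ^ 2))
  have h2 : (c : ℝ) ≤ 2 * ((G.h n / n ^ 2 : ℕ) : ℝ) := by exact_mod_cast hc
  rw [div_le_iff₀ hh]
  calc (c : ℝ) ≤ 2 * ((G.h n : ℝ) / (n : ℝ) ^ 2) := by linarith
    _ = _ := by ring

theorem μ_real_edgeLevels_le {n : ℕ} (hn : 1 ≤ n) :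
    G.μ.real (G.edgeLevels n) ≤ 2 * (1 / (n : ℝ) ^ 2) := by
  refine (G.μ_real_biUnion_level_le hn (Finset.filter_subset _ _)).trans (G.card_div_h_le ?_)
  refine (Finset.card_le_card (t := Finset.range (G.h n / n ^ 2) ∪
    Finset.Ico (G.h n - G.h n / n ^ 2) (G.h n)) fun r hr => ?_).trans
    ((Finset.card_union_le _ _).trans ?_)
  · simp only [Finset.mem_filter, Finset.mem_range, Finset.mem_union, Finset.mem_Ico] at hr ⊢
    omega
  · rw [Finset.card_range, Nat.card_Ico]
    omega

theorem μ_real_nearLevels_le {n : ℕ} (hn : 1 ≤ n) (x : ℝ) :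
    G.μ.real (G.nearLevels n x) ≤ 2 * (1 / (n : ℝ) ^ 2) := by
  classical
  refine (G.μ_real_biUnion_level_le hn (Finset.filter_subset _ _)).trans (G.card_div_h_le ?_)
  by_cases hx : ∃ l < G.h n, x ∈ G.level n l
  · obtain ⟨l, hl, hxl⟩ := hx
    refine (Finset.card_le_card (t := Finset.Ico (l - G.h n / n ^ 2) l ∪
      Finset.Ico l (l + G.h n / n ^ 2)) fun r hr => ?_).trans
      ((Finset.card_union_le _ _).trans ?_)
    · simp only [Finset.mem_filter, Finset.mem_range, Finset.mem_union, Finset.mem_Ico] at hr ⊢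
      obtain ⟨-, l', hl', hxl', h1, h2⟩ := hr
      obtain rfl := G.level_disjoint hn l hl l' hl' x hxl hxl'
      omega
    · rw [Nat.card_Ico, Nat.card_Ico]
      omega
  · rw [Finset.filter_eq_empty_iff.2]
    · simp
    · rintro r - ⟨l, hl, hxl, -⟩
      exact hx ⟨l, hl, hxl⟩

/-- About `h_n^(γ/4)` columns are removed at each side, each of measure at most `1 / p_n ≤
h_n^(-γ)`. Since `h_n ≥ 2^(n-1)`, the result is a geometric bound. -/
theorem μ_real_edgeColumns_le {γ : ℝ} (hγ : 0 < γ) {n : ℕ} (hn : 1 ≤ n)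
    (hp : (G.h n : ℝ) ^ γ ≤ G.p n) :
    G.μ.real (G.edgeColumns γ n) ≤ 3 * ((2 : ℝ) ^ (-(3 * γ / 4))) ^ (n - 1) := by
  classical
  have hh : (1 : ℝ) ≤ G.h n := by exact_mod_cast G.h_pos n
  have hh0 : (0 : ℝ) < G.h n := by linarith
  have hp0 : (0 : ℝ) < G.p n := lt_of_lt_of_le (by positivity) hp
  set H : ℝ := (G.h n : ℝ) ^ (γ / 4) with hH
  have hH1 : 1 ≤ H := Real.one_le_rpow hh (by positivity)
  have hcol : ∀ c ∈ (Finset.Icc 1 (G.p n)).filter fun c : ℕ => (c : ℝ) < H ∨ (G.p n : ℝ) - H < c,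
      G.μ.real (⋃ r ∈ Finset.range (G.h n), G.level (n + 1) (G.start n c + r)) ≤
        1 / G.p n := by
    intro c hc
    simp only [Finset.mem_filter, Finset.mem_Icc] at hc
    refine (measureReal_biUnion_finset_le _ _).trans ((Finset.sum_le_card_nsmul _ _
      (1 / (G.h (n + 1) : ℝ)) fun r hr => ?_).trans ?_)
    · exact G.μ_real_level_le (by omega)
        (G.start_add_lt hn hc.1.1 hc.1.2 (Finset.mem_range.1 hr))
    · rw [Finset.card_range, nsmul_eq_mul, mul_one_div,
        div_le_div_iff₀ (by exact_mod_cast G.h_pos _) hp0]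
      have := G.p_mul_h_le hn
      have h2 : (G.p n : ℝ) * G.h n ≤ G.h (n + 1) := by exact_mod_cast this
      linarith
  -- The count is at most `2⌊H⌋ + 1`, which is at most `3 H` because `H ≥ 1`.
  have hcard : (((Finset.Icc 1 (G.p n)).filter fun c : ℕ => (c : ℝ) < H ∨ (G.p n : ℝ) - H < c).card : ℝ) ≤
      3 * H := by
    have h1 : ((Finset.Icc 1 (G.p n)).filter fun c : ℕ => (c : ℝ) < H ∨ (G.p n : ℝ) - H < c).card ≤
        ⌊H⌋₊ + (⌊H⌋₊ + 1) := by
      refine (Finset.card_le_card (t := Finset.Icc 1 ⌊H⌋₊ ∪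
        Finset.Icc (G.p n - ⌊H⌋₊) (G.p n)) fun c hc => ?_).trans
        ((Finset.card_union_le _ _).trans ?_)
      · simp only [Finset.mem_filter, Finset.mem_union, Finset.mem_Icc] at hc ⊢
        obtain ⟨⟨h1, h2⟩, h3 | h3⟩ := hc
        · exact Or.inl ⟨h1, Nat.le_floor h3.le⟩
        · right
          refine ⟨?_, h2⟩
          have : G.p n - c ≤ ⌊H⌋₊ := Nat.le_floor (by push_cast [h2]; linarith)
          omega
      · rw [Nat.card_Icc, Nat.card_Icc]
        omega
    have h2 := Nat.floor_le (show 0 ≤ H by linarith)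
    have h3 : (((Finset.Icc 1 (G.p n)).filter fun c : ℕ => (c : ℝ) < H ∨ (G.p n : ℝ) - H < c).card : ℝ) ≤
        ⌊H⌋₊ + (⌊H⌋₊ + 1) := by exact_mod_cast h1
    linarith
  calc G.μ.real (G.edgeColumns γ n) ≤ _ := measureReal_biUnion_finset_le _ _
    _ ≤ _ := Finset.sum_le_card_nsmul _ _ _ hcol
    _ ≤ 3 * H * (1 / G.p n) := by
        rw [nsmul_eq_mul]
        exact mul_le_mul_of_nonneg_right hcard (by positivity)
    _ ≤ 3 * H * (1 / (G.h n : ℝ) ^ γ) := by gcongr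
    _ = 3 * (G.h n : ℝ) ^ (-(3 * γ / 4)) := by
        rw [hH, mul_assoc, one_div, ← Real.rpow_neg hh0.le, ← Real.rpow_add hh0]
        ring_nf
    _ ≤ 3 * ((2 : ℝ) ^ (n - 1)) ^ (-(3 * γ / 4)) := by
        refine mul_le_mul_of_nonneg_left ?_ (by norm_num)
        refine Real.rpow_le_rpow_of_nonpos (by positivity) ?_ (by linarith)
        have := G.two_pow_le_h (n - 1)
        rw [Nat.sub_add_cancel hn] at this
        exact_mod_cast this
    _ = _ := by
        rw [← Real.rpow_natCast, ← Real.rpow_natCast, ← Real.rpow_mul (by norm_num),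
          ← Real.rpow_mul (by norm_num), mul_comm (_ : ℝ) ((n - 1 : ℕ) : ℝ)]

theorem iterate_map_eq {n : ℕ} (hn : 1 ≤ n) {x : ℝ} (hx : x ∈ G.level n 0) :
    ∀ {i : ℕ}, i < G.h n → G.map^[i] x = x - G.left n 0 + G.left n i
  | 0, _ => by simp
  | i + 1, hi => by
    have h1 := G.iterate_map_mem_level hn hx (i := i) (by omega)
    rw [zero_add] at h1
    rw [Function.iterate_succ_apply', G.map_eq hn hi h1, iterate_map_eq hn hx (by omega)]
    ring

theorem image_iterate_map_base {n i : ℕ} (hn : 1 ≤ n) (hi : i < G.h n) :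
    G.map^[i] '' G.base n = G.level n i := by
  ext x
  constructor
  · rintro ⟨b, hb, rfl⟩
    have := G.iterate_map_mem_level hn hb (i := i) (by omega)
    rwa [zero_add] at this
  · intro hx
    have hb : x - G.left n i + G.left n 0 ∈ G.level n 0 :=
      ⟨by linarith [hx.1], by linarith [hx.2]⟩
    refine ⟨_, hb, ?_⟩
    rw [G.iterate_map_eq hn hb hi]
    ring

theorem column_eq {n c : ℕ} (hn : 1 ≤ n) (hc : 1 ≤ c) (hcp : c ≤ G.p n) :
    G.column n c = ⋃ r ∈ Finset.range (G.h n), G.level (n + 1) (G.start n c + r) := by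
  refine iUnion₂_congr fun r hr => ?_
  rw [G.level_start_add_eq hn hc hcp (Finset.mem_range.1 hr)]

theorem mem_Fset {γ : ℝ} {n : ℕ} (hn : 1 ≤ n) {x : ℝ} (hx : x ∈ G.tower n)
    (h1 : x ∉ G.edgeLevels n) (h2 : x ∉ G.edgeColumns γ n) : x ∈ G.Fset γ n := by
  obtain ⟨r, hr, hxr⟩ := G.mem_tower_iff.1 hx
  obtain ⟨c, hc, hcp, hxc⟩ := G.exists_mem_level_start_add hn hr hxr
  simp only [edgeLevels, mem_iUnion, Finset.mem_filter, Finset.mem_range, exists_prop] at h1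
  simp only [edgeColumns, mem_iUnion, Finset.mem_filter, Finset.mem_range, Finset.mem_Icc,
    exists_prop] at h2
  refine ⟨mem_iUnion₂.2 ⟨r, ?_, ?_⟩, mem_iUnion₂.2 ⟨c, ?_, ?_⟩⟩
  · by_contra hcon
    rw [Finset.mem_Icc] at hcon
    exact h1 ⟨r, ⟨hr, by omega⟩, hxr⟩
  · rwa [G.image_iterate_map_base hn hr]
  · by_contra hcon
    refine h2 ⟨c, ⟨⟨hc, hcp⟩, ?_⟩, r, hr, hxc⟩
    by_contra! h3
    exact hcon h3
  · rw [G.column_eq hn hc hcp]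
    exact mem_iUnion₂.2 ⟨r, Finset.mem_range.2 hr, hxc⟩

/-- The condition `n² ≤ h_n` makes the margin `h_n / n²` at least `1`. Without it the range of
iterates in `Fset` would include `h_n`, which no longer lands in a level of the tower. -/
theorem exists_of_mem_Fset {γ : ℝ} (hγ : 0 < γ) {n : ℕ} (hn : 1 ≤ n) (hnh : n ^ 2 ≤ G.h n)
    {x : ℝ} (hx : x ∈ G.Fset γ n) :
    ∃ r c : ℕ, r < G.h n ∧ G.h n / n ^ 2 ≤ r ∧ r + G.h n / n ^ 2 ≤ G.h n ∧ x ∈ G.level n r ∧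
      1 ≤ c ∧ (c : ℝ) ≤ G.p n - (G.h n : ℝ) ^ (γ / 4) ∧ c ≤ G.p n ∧
      x ∈ G.level (n + 1) (G.start n c + r) := by
  obtain ⟨h1, h2⟩ := hx
  obtain ⟨r, hr, hxr⟩ := mem_iUnion₂.1 h1
  obtain ⟨c, ⟨hc, hcp⟩, hxc⟩ := mem_iUnion₂.1 h2
  rw [Finset.mem_Icc] at hr
  have hq : 1 ≤ G.h n / n ^ 2 := (Nat.one_le_div_iff (by positivity)).2 hnh
  have hqh : G.h n / n ^ 2 ≤ G.h n := Nat.div_le_self _ _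
  have hrh : r < G.h n := by omega
  have hh : (1 : ℝ) ≤ G.h n := by exact_mod_cast G.h_pos n
  have hH : 1 ≤ (G.h n : ℝ) ^ (γ / 4) := Real.one_le_rpow hh (by positivity)
  have hc1 : 1 ≤ c := by exact_mod_cast hH.trans hc
  have hcp1 : c ≤ G.p n := by
    have : (c : ℝ) ≤ G.p n := by linarith
    exact_mod_cast this
  rw [G.image_iterate_map_base hn hrh] at hxr
  rw [G.column_eq hn hc1 hcp1] at hxc
  obtain ⟨r', hr', hxc⟩ := mem_iUnion₂.1 hxc
  rw [Finset.mem_range] at hr'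
  obtain rfl := G.level_disjoint hn r hrh r' hr' x hxr
    (G.level_start_add_subset hn hc1 hcp1 hr' hxc)
  exact ⟨r, c, hrh, hr.1, by omega, hxr, hc1, hcp, hcp1, hxc⟩

theorem base_subset_space {n : ℕ} (hn : 1 ≤ n) : G.base n ⊆ G.space :=
  (G.level_subset_tower (G.h_pos n)).trans (G.tower_subset_space hn)

/-- For small `n` an iterate of the base may leave the tower and need not be a level. Injectivity of
the map on the phase space gives measurability of the image in all cases. -/
theorem measurableSet_Fset (γ : ℝ) {n : ℕ} (hn : 1 ≤ n) : MeasurableSet (G.Fset γ n) := by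
  refine MeasurableSet.inter (Finset.measurableSet_biUnion _ fun i _ => ?_)
    (MeasurableSet.biUnion (to_countable _) fun c _ =>
      Finset.measurableSet_biUnion _ fun _ _ => measurableSet_Ico)
  exact (G.measurableSet_level _ _).image_of_measurable_injOn (G.measurable_map.iterate i)
    ((G.injOn_map.iterate G.mapsTo_map i).mono (G.base_subset_space hn))

theorem measurableSet_F (γ : ℝ) {n₁ : ℕ} (hn : 1 ≤ n₁) : MeasurableSet (G.F γ n₁) :=
  MeasurableSet.biInter (to_countable _) fun _ hi => G.measurableSet_Fset γ (le_trans hn hi)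

theorem summable_two_div_sq : Summable fun n : ℕ => 2 * (1 / (n : ℝ) ^ 2) :=
  (Real.summable_one_div_nat_pow.2 one_lt_two).mul_left 2

/-- An admissible starting index exists. -/
theorem exists_admissible {γ γ' : ℝ} (hγ : 0 < γ) (hG : G.MemC γ γ') : ∃ n, G.Admissible γ n := by
  obtain ⟨n', hn', hC⟩ := hG
  have hs2 : Summable fun n : ℕ => 3 * ((2 : ℝ) ^ (-(3 * γ / 4))) ^ (n - 1) := by
    rw [← summable_nat_add_iff 1]
    refine (summable_geometric_of_lt_one (by positivity) ?_).mul_left 3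
    exact Real.rpow_lt_one_of_one_lt_of_neg one_lt_two (by linarith)
  have hε : (0 : ℝ) < 10 ^ (-5 : ℤ) / 3 := by positivity
  obtain ⟨N₁, h₁⟩ := exists_measureReal_biUnion_Ici_le G.μ summable_two_div_sq hε
  obtain ⟨N₂, h₂⟩ := exists_measureReal_biUnion_Ici_le G.μ hs2 hε
  obtain ⟨N₃, h₃⟩ := Filter.eventually_atTop.1
    (G.tendsto_μ_real_compl_tower.eventually (gt_mem_nhds hε))
  set M := max (max N₁ N₂) (max N₃ n') with hM
  have hM1 : 1 ≤ M := by omega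
  refine ⟨M, hM1, ?_⟩
  generalize (10 : ℝ) ^ (-5 : ℤ) = ε at *
  have b₁ := h₁ M (by omega) G.edgeLevels fun n hn => G.μ_real_edgeLevels_le (by omega)
  have b₂ := h₂ M (by omega) (G.edgeColumns γ) fun n hn =>
    G.μ_real_edgeColumns_le hγ (by omega) (hC n (by omega)).1
  have b₃ := h₃ M (by omega)
  have hsub : (G.F γ M)ᶜ ⊆ ((⋃ n ∈ Ici M, G.edgeLevels n) ∪ ⋃ n ∈ Ici M, G.edgeColumns γ n) ∪
      (G.tower M)ᶜ := by
    intro x hx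
    by_contra hcon
    simp only [mem_union, mem_iUnion, mem_Ici, exists_prop, not_or, not_exists, not_and,
      mem_compl_iff, not_not] at hcon
    obtain ⟨⟨c1, c2⟩, c3⟩ := hcon
    exact hx (mem_iInter₂.2 fun n hn =>
      G.mem_Fset (le_trans hM1 hn) (G.tower_mono hM1 hn c3) (c1 n hn) (c2 n hn))
  have b := (measureReal_mono (μ := G.μ) hsub).trans ((measureReal_union_le _ _).trans
    (add_le_add_left (measureReal_union_le _ _) _))
  rw [probReal_compl_eq_one_sub (G.measurableSet_F γ hM1)] at b
  linarith

/-- The points of the `M`-th tower that do not lie in an extreme level of any later tower. -/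
def core (M : ℕ) : Set ℝ := G.tower M \ ⋃ n ∈ Ici M, G.edgeLevels n

theorem measurableSet_core (M : ℕ) : MeasurableSet (G.core M) :=
  (G.measurableSet_tower M).diff
    (MeasurableSet.biUnion (to_countable _) fun _ _ => G.measurableSet_edgeLevels _)

theorem exists_of_mem_core {M n : ℕ} (hM : 1 ≤ M) (hn : M ≤ n) {x : ℝ} (hx : x ∈ G.core M) :
    ∃ r < G.h n, r + G.h n / n ^ 2 ≤ G.h n ∧ x ∈ G.level n r := by
  obtain ⟨h1, h2⟩ := hx
  obtain ⟨r, hr, hxr⟩ := G.mem_tower_iff.1 (G.tower_mono hM hn h1)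
  refine ⟨r, hr, ?_, hxr⟩
  by_contra hcon
  refine h2 (mem_iUnion₂.2 ⟨n, hn, mem_iUnion₂.2 ⟨r, ?_, hxr⟩⟩)
  rw [Finset.mem_filter, Finset.mem_range]
  omega

theorem exists_μ_real_compl_core_le {ε : ℝ} (hε : 0 < ε) : ∃ N, ∀ M ≥ N,
    G.μ.real (G.core M)ᶜ ≤ ε ∧ ∀ x, G.μ.real (⋃ n ∈ Ici M, G.nearLevels n x) ≤ ε := by
  have hε2 : 0 < ε / 2 := by positivity
  obtain ⟨N₁, h₁⟩ := exists_measureReal_biUnion_Ici_le G.μ summable_two_div_sq hε2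
  obtain ⟨N₃, h₃⟩ := Filter.eventually_atTop.1
    (G.tendsto_μ_real_compl_tower.eventually (gt_mem_nhds hε2))
  refine ⟨max 1 (max N₁ N₃), fun M hM => ⟨?_, fun x => ?_⟩⟩
  · have b₁ := h₁ M (by omega) G.edgeLevels fun n hn => G.μ_real_edgeLevels_le (by omega)
    have b₃ := h₃ M (by omega)
    have e : (G.core M)ᶜ = (G.tower M)ᶜ ∪ ⋃ n ∈ Ici M, G.edgeLevels n := by
      rw [core, sdiff_eq, compl_inter, compl_compl]
    rw [e]
    refine (measureReal_union_le _ _).trans ?_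
    linarith
  · have := h₁ M (by omega) (fun n => G.nearLevels n x) fun n hn =>
      G.μ_real_nearLevels_le (by omega) x
    linarith

end RankOne

/-! ### Counting matched times at one pair of towers -/

/-- Along a matching both window indices are nondecreasing, so their sum determines the pair of
windows: equal sums force equal indices. The sum takes at most `2 (N / W) + 1` values, and in each
class all times lie within `h` of the first. -/
theorem card_le_of_windows {r N : ℕ} {i j : Fin r → Fin N} (hi : StrictMono i) (hj : StrictMono j)
    (A : Finset (Fin r)) {h W : ℕ} (hh : 0 < h) (hW : 0 < W)
    (hA : ∀ s ∈ A, ∀ t ∈ A, s < t → (i t : ℕ) < i s + W → (j t : ℕ) < j s + W →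
      (i t : ℕ) < i s + h) :
    A.card ≤ h * (2 * (N / W) + 1) := by
  set κ : Fin r → ℕ := fun s => (i s : ℕ) / W + (j s : ℕ) / W with hκ
  have himg : (A.image κ).card ≤ 2 * (N / W) + 1 := by
    refine (Finset.card_le_card (t := Finset.range (2 * (N / W) + 1)) fun a ha => ?_).trans
      (Finset.card_range _).le
    obtain ⟨s, -, rfl⟩ := Finset.mem_image.1 ha
    have h1 := Nat.div_le_div_right (c := W) (i s).2.le
    have h2 := Nat.div_le_div_right (c := W) (j s).2.le
    simp only [Finset.mem_range, hκ]
    omega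
  refine (Finset.card_le_mul_card_image A h fun a ha => ?_).trans (Nat.mul_le_mul_left _ himg)
  have hne : (A.filter fun s => κ s = a).Nonempty := by
    obtain ⟨s, hs, rfl⟩ := Finset.mem_image.1 ha
    exact ⟨s, Finset.mem_filter.2 ⟨hs, rfl⟩⟩
  obtain ⟨s, hs, hmin⟩ := Finset.exists_min_image _ id hne
  have hs' := Finset.mem_filter.1 hs
  have key : ∀ t ∈ A.filter (fun s => κ s = a), (i t : ℕ) ∈ Finset.Ico (i s : ℕ) (i s + h) := by
    intro t ht
    have ht' := Finset.mem_filter.1 ht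
    have hst : s ≤ t := hmin t ht
    have his : (i s : ℕ) ≤ i t := hi.monotone hst
    have hjs : (j s : ℕ) ≤ j t := hj.monotone hst
    rw [Finset.mem_Ico]
    refine ⟨his, ?_⟩
    rcases hst.eq_or_lt with rfl | hlt
    · omega
    have e : (i s : ℕ) / W + (j s : ℕ) / W = (i t : ℕ) / W + (j t : ℕ) / W :=
      hs'.2.trans ht'.2.symm
    have d1 := Nat.div_le_div_right (c := W) his
    have d2 := Nat.div_le_div_right (c := W) hjs
    have win : ∀ {a b : ℕ}, b / W = a / W → b < a + W := by
      intro a b hab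
      have h1 := Nat.div_add_mod a W
      have h2 := Nat.div_add_mod b W
      have h3 := Nat.mod_lt b hW
      rw [hab] at h2
      omega
    exact hA s hs'.1 t ht'.1 hlt (win (by omega)) (win (by omega))
  calc _ ≤ (Finset.Ico (i s : ℕ) (i s + h)).card :=
        Finset.card_le_card_of_injOn (fun t => (i t : ℕ)) key
          fun a _ b _ hab => hi.injective (Fin.ext hab)
    _ = h := by rw [Nat.card_Ico]; omega

namespace RankOne

variable (G : RankOne)

theorem start_add_eq {n c : ℕ} (hc : 1 ≤ c) (q : ℕ) :
    G.start n (c + q) = G.start n c + (q * G.h n + ∑ l ∈ Finset.range q, G.a n (c + l)) := by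
  induction q with
  | zero => simp
  | succ q ih =>
    rw [← add_assoc, G.start_succ n (by omega), ih, Finset.sum_range_succ]
    ring

theorem a_le_a_p {n : ℕ} (ha : ∀ i, 2 ≤ i → i ≤ G.p n → G.a n (i - 1) < G.a n i) {c : ℕ}
    (hc : 1 ≤ c) : ∀ {d : ℕ}, c ≤ d → d ≤ G.p n → G.a n c ≤ G.a n d := by
  intro d hcd
  induction d, hcd using Nat.le_induction with
  | base => exact fun _ => le_rfl
  | succ d hd ih =>
    intro hp
    have := ha (d + 1) (by omega) hp
    rw [Nat.add_sub_cancel] at this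
    exact (ih (by omega)).trans this.le

theorem a_lt_a {n : ℕ} (ha : ∀ i, 2 ≤ i → i ≤ G.p n → G.a n (i - 1) < G.a n i) {c d : ℕ}
    (hc : 1 ≤ c) (hcd : c < d) (hd : d ≤ G.p n) : G.a n c < G.a n d := by
  have h1 := G.a_le_a_p ha hc (show c ≤ d - 1 by omega) (by omega)
  exact h1.trans_lt (ha d (by omega) hd)

/-- Two orbit pieces of the same length that start and end in one level of the `n`-th tower, in
different columns, do not leave their columns, because the spacers are increasing. -/
theorem column_eq_of_start_eq {n Q c₀ c₁ d₀ d₁ x r : ℕ}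
    (ha : ∀ i, 2 ≤ i → i ≤ G.p n → G.a n (i - 1) < G.a n i) (hQ : Q * G.a n (G.p n) < G.h n)
    (hc₀ : 1 ≤ c₀) (hc : c₀ < c₁) (hd₀ : 1 ≤ d₀) (hd₁ : 1 ≤ d₁) (hd₀p : d₀ ≤ G.p n)
    (hd₁p : d₁ ≤ G.p n) (hr : r < G.h n) (hx : x < Q * G.h n)
    (e₀ : G.start n c₀ + x = G.start n d₀ + r) (e₁ : G.start n c₁ + x = G.start n d₁ + r) :
    x = r := by
  have le : ∀ {c d : ℕ}, 1 ≤ d → G.start n c + x = G.start n d + r → c ≤ d := by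
    intro c d hd e
    by_contra! hlt
    have h1 := G.start_mono n (show d + 1 ≤ c by omega)
    rw [G.start_succ n hd] at h1
    omega
  obtain ⟨q₀, rfl⟩ := Nat.exists_eq_add_of_le (le hd₀ e₀)
  obtain ⟨q₁, rfl⟩ := Nat.exists_eq_add_of_le (le hd₁ e₁)
  rw [G.start_add_eq hc₀] at e₀
  rw [G.start_add_eq (show 1 ≤ c₁ by omega)] at e₁
  have small : ∀ {c q : ℕ}, 1 ≤ c → c + q ≤ G.p n → q * G.h n ≤ x →
      ∑ l ∈ Finset.range q, G.a n (c + l) < G.h n := by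
    intro c q hc hcq hq
    have hqQ : q ≤ Q := by
      by_contra! hlt
      have := Nat.mul_le_mul_right (G.h n) hlt.le
      omega
    refine lt_of_le_of_lt ?_ hQ
    calc _ ≤ ∑ l ∈ Finset.range q, G.a n (G.p n) := Finset.sum_le_sum fun l hl =>
          G.a_le_a_p ha (by omega) (by have := Finset.mem_range.1 hl; omega) le_rfl
      _ = q * G.a n (G.p n) := by simp
      _ ≤ _ := Nat.mul_le_mul_right _ hqQ
  set A₀ := ∑ l ∈ Finset.range q₀, G.a n (c₀ + l) with hA₀
  set A₁ := ∑ l ∈ Finset.range q₁, G.a n (c₁ + l) with hA₁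
  rcases Nat.eq_zero_or_pos q₀ with h0 | hpos
  · simp only [h0, Finset.range_zero, Finset.sum_empty] at hA₀
    rw [h0] at e₀
    omega
  exfalso
  have ex : x ≥ r := by
    have : G.h n ≤ q₀ * G.h n := Nat.le_mul_of_pos_left _ hpos
    omega
  by_cases hbig : q₀ * G.h n ≤ x ∧ q₁ * G.h n ≤ x
  · have s₀ : A₀ < G.h n := small hc₀ hd₀p hbig.1
    have s₁ : A₁ < G.h n := small (by omega) hd₁p hbig.2
    -- Both remainders are below `h_n`, so the quotients agree: the same number of columns is
    -- crossed. Comparing spacers column by column then gives `A₀ < A₁`, a contradiction.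
    have e : q₀ * G.h n + A₀ = q₁ * G.h n + A₁ := by omega
    have hqq : q₀ = q₁ := by
      rcases lt_trichotomy q₀ q₁ with hl | he | hl
      · have := Nat.mul_le_mul_right (G.h n) (show q₀ + 1 ≤ q₁ from hl)
        rw [add_mul] at this
        omega
      · exact he
      · have := Nat.mul_le_mul_right (G.h n) (show q₁ + 1 ≤ q₀ from hl)
        rw [add_mul] at this
        omega
    subst hqq
    have hlt : A₀ < A₁ := Finset.sum_lt_sum_of_nonempty ⟨0, Finset.mem_range.2 hpos⟩ fun l hl =>
      G.a_lt_a ha (by omega) (by omega) (by have := Finset.mem_range.1 hl; omega)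
    omega
  · omega

/-- If two points of `F_n` lie in one level of the `n`-th tower but not of the next one, and return
simultaneously to one level of the `n`-th tower, then this happens during the same passage. -/
theorem lt_h_of_sameLevel {γ : ℝ} (hγ : 0 < γ) {n Q u : ℕ} (hn : 1 ≤ n) (hnh : n ^ 2 ≤ G.h n)
    (ha : ∀ i, 2 ≤ i → i ≤ G.p n → G.a n (i - 1) < G.a n i)
    (hQa : (Q + 1) * G.a n (G.p n) < G.h n) (hQ : ((Q + 1 : ℕ) : ℝ) ≤ (G.h n : ℝ) ^ (γ / 4))
    (hu : u < Q * G.h n) {x y : ℝ}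
    (hx : x ∈ G.Fset γ n) (hy : y ∈ G.Fset γ n) (hxy : G.SameLevel n x y)
    (hxy' : ¬G.SameLevel (n + 1) x y) (hux : G.map^[u] x ∈ G.Fset γ n)
    (huy : G.map^[u] y ∈ G.Fset γ n) (huxy : G.SameLevel n (G.map^[u] x) (G.map^[u] y)) :
    u < G.h n := by
  obtain ⟨r, c₀, hr, -, -, hxr, hc₀, hc₀p, hc₀p', hxc⟩ := G.exists_of_mem_Fset hγ hn hnh hx
  obtain ⟨r₁, c₁, hr₁, -, -, hyr, hc₁, hc₁p, hc₁p', hyc⟩ := G.exists_of_mem_Fset hγ hn hnh hy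
  obtain ⟨s, d₀, hs, -, -, hxs, hd₀, -, hd₀p, hxd⟩ := G.exists_of_mem_Fset hγ hn hnh hux
  obtain ⟨s₁, d₁, hs₁, -, -, hys, hd₁, -, hd₁p, hyd⟩ := G.exists_of_mem_Fset hγ hn hnh huy
  obtain ⟨l, hl, hxl, hyl⟩ := hxy
  obtain rfl := G.level_disjoint hn l hl r hr x hxl hxr
  obtain rfl := G.level_disjoint hn l hl r₁ hr₁ y hyl hyr
  obtain ⟨l', hl', hxl', hyl'⟩ := huxy
  obtain rfl := G.level_disjoint hn l' hl' s hs _ hxl' hxs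
  obtain rfl := G.level_disjoint hn l' hl' s₁ hs₁ _ hyl' hys
  have hne : c₀ ≠ c₁ := by
    rintro rfl
    exact hxy' ⟨_, G.start_add_lt hn hc₀ hc₀p' hl, hxc, hyc⟩
  -- Points of `F_n` have at least `Q + 1` columns above them, so the orbit stays in tower `n + 1`
  -- up to time `u` and its level number there simply grows by `u`.
  have bound : ∀ {c d : ℕ} {z : ℝ}, 1 ≤ c → (c : ℝ) ≤ G.p n - (G.h n : ℝ) ^ (γ / 4) →
      z ∈ G.level (n + 1) (G.start n c + l) → 1 ≤ d → d ≤ G.p n →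
      G.map^[u] z ∈ G.level (n + 1) (G.start n d + l') →
      G.start n c + (l + u) = G.start n d + l' := by
    intro c d z hc hcp hz hd hdp hz'
    have hcQ : c + (Q + 1) ≤ G.p n := by
      have : ((c + (Q + 1) : ℕ) : ℝ) ≤ G.p n := by push_cast at hQ ⊢; linarith
      exact_mod_cast this
    have h1 := G.start_mono n (show c + (Q + 1) ≤ G.p n + 1 by omega)
    rw [G.start_add_eq hc, G.start_top hn, add_mul] at h1
    have hlt : G.start n c + l + u < G.h (n + 1) := by omega
    have := G.level_disjoint (by omega) _ hlt _ (G.start_add_lt hn hd hdp hl') _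
      (G.iterate_map_mem_level (by omega) hz hlt) hz'
    omega
  have e₀ := bound hc₀ hc₀p hxc hd₀ hd₀p hxd
  have e₁ := bound hc₁ hc₁p hyc hd₁ hd₁p hyd
  have hlu : l + u < (Q + 1) * G.h n := by rw [add_mul]; omega
  rcases lt_or_gt_of_ne hne with hlt | hlt
  · have := G.column_eq_of_start_eq ha hQa hc₀ hlt hd₀ hd₁ hd₀p hd₁p hl' hlu e₀ e₁
    omega
  · have := G.column_eq_of_start_eq ha hQa hc₁ hlt hd₁ hd₀ hd₁p hd₀p hl' hlu e₁ e₀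
    omega

/-- If two points of `F_n` lie in one level of the `n`-th tower, and also after short times `u`
and `v`, then `u = v`. -/
theorem eq_of_sameLevel {γ : ℝ} (hγ : 0 < γ) {n u v : ℕ} (hn : 1 ≤ n) (hnh : n ^ 2 ≤ G.h n)
    (hu : u < G.h n / n ^ 2) (hv : v < G.h n / n ^ 2) {x y : ℝ} (hx : x ∈ G.Fset γ n)
    (hxy : G.SameLevel n x y)
    (huv : G.SameLevel n (G.map^[u] x) (G.map^[v] y)) : u = v := by
  obtain ⟨r, c₀, hr, -, hrq, hxr, -⟩ := G.exists_of_mem_Fset hγ hn hnh hx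
  obtain ⟨l, hl, hxl, hyl⟩ := hxy
  obtain rfl := G.level_disjoint hn l hl r hr x hxl hxr
  obtain ⟨l', hl', hxl', hyl'⟩ := huv
  have h1 := G.level_disjoint hn _ (by omega) _ hl' _
    (G.iterate_map_mem_level hn hxl (i := u) (by omega)) hxl'
  have h2 := G.level_disjoint hn _ (by omega) _ hl' _
    (G.iterate_map_mem_level hn hyl (i := v) (by omega)) hyl'
  omega

end RankOne

open RankOne in
/-- The number of matched times at which the points are at distance `1 / h m` for `T` and are
closer for `S`. -/
theorem card_matched_le {T S : RankOne} {γ : ℝ} (hγ : 0 < γ) {m n k N r : ℕ}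
    {i j : Fin r → Fin N} (hi : StrictMono i) (hj : StrictMono j) (hk : 1 ≤ k)
    (hm : 1 ≤ m) (hmh : m ^ 2 ≤ T.h m) (hn : 1 ≤ n) (hnh : n ^ 2 ≤ S.h n)
    (ha : ∀ i, 2 ≤ i → i ≤ T.p m → T.a m (i - 1) < T.a m i)
    (hQa : (8 * k ^ 2 + 1) * T.a m (T.p m) < T.h m)
    (hQ : ((8 * k ^ 2 + 1 : ℕ) : ℝ) ≤ (T.h m : ℝ) ^ (γ / 4))
    (hW : 8 * k ^ 2 * T.h m ≤ S.h n / n ^ 2) {x y x' y' : ℝ} (A : Finset (Fin r))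
    (hA : ∀ s ∈ A, T.map^[i s] x ∈ T.Fset γ m ∧ T.map^[j s] x' ∈ T.Fset γ m ∧
      T.SameLevel m (T.map^[i s] x) (T.map^[j s] x') ∧
      ¬T.SameLevel (m + 1) (T.map^[i s] x) (T.map^[j s] x') ∧
      S.map^[i s] y ∈ S.Fset γ n ∧ S.SameLevel n (S.map^[i s] y) (S.map^[j s] y'))
    {l l' : ℕ} (hl : l + S.h n / n ^ 2 ≤ S.h n) (hl' : l' + S.h n / n ^ 2 ≤ S.h n)
    (hyl : y ∈ S.level n l) (hyl' : y' ∈ S.level n l')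
    (hfar : ¬(l' < l + S.h n / n ^ 2 ∧ l < l' + S.h n / n ^ 2)) :
    (A.card : ℝ) ≤ N / (2 * (k : ℝ) ^ 2) := by
  have hh := T.h_pos m
  have hk2 : 0 < k ^ 2 := by positivity
  have hWpos : 0 < 8 * k ^ 2 * T.h m := by positivity
  -- For short words the additive term `h_m` of the window count is too large. There both orbits
  -- climb less than the margin, while their starting levels in the `S`-tower differ by at least the
  -- margin, so they never share a level.
  rcases lt_or_ge N (4 * k ^ 2 * T.h m) with hN | hN
  · have hemp : A = ∅ := by
      refine Finset.eq_empty_of_forall_notMem fun s hs => ?_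
      obtain ⟨-, -, -, -, -, l₂, hl₂, h1, h2⟩ := hA s hs
      have hNq : N < S.h n / n ^ 2 := by
        have : 4 * k ^ 2 * T.h m ≤ 8 * k ^ 2 * T.h m :=
          Nat.mul_le_mul_right _ (Nat.mul_le_mul_right _ (by norm_num))
        omega
      have e1 := S.level_disjoint hn _ (by have := (i s).2; omega) _ hl₂ _
        (S.iterate_map_mem_level hn hyl (i := i s) (by have := (i s).2; omega)) h1
      have e2 := S.level_disjoint hn _ (by have := (j s).2; omega) _ hl₂ _
        (S.iterate_map_mem_level hn hyl' (i := j s) (by have := (j s).2; omega)) h2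
      have := (i s).2
      have := (j s).2
      omega
    rw [hemp, Finset.card_empty, Nat.cast_zero]
    positivity
  · have hcard : A.card ≤ T.h m * (2 * (N / (8 * k ^ 2 * T.h m)) + 1) := by
      refine card_le_of_windows hi hj A hh hWpos fun s hs t ht hst hit hjt => ?_
      obtain ⟨u, hu⟩ := Nat.exists_eq_add_of_le (show (i s : ℕ) ≤ i t from hi.monotone hst.le)
      obtain ⟨v, hv⟩ := Nat.exists_eq_add_of_le (show (j s : ℕ) ≤ j t from hj.monotone hst.le)
      obtain ⟨a1, a2, a3, a4, a5, a6⟩ := hA s hs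
      obtain ⟨b1, b2, b3, b4, b5, b6⟩ := hA t ht
      rw [hu, add_comm, Function.iterate_add_apply] at b1 b3 b6
      rw [hv, add_comm, Function.iterate_add_apply] at b2 b3 b6
      have huv : u = v := S.eq_of_sameLevel hγ hn hnh (by omega) (by omega) a5 a6 b6
      subst huv
      have := T.lt_h_of_sameLevel hγ hm hmh ha hQa hQ (u := u) (by omega) a1 a2 a3 a4 b1 b2 b3
      omega
    have c1 : (A.card : ℝ) ≤ T.h m * (2 * ((N / (8 * k ^ 2 * T.h m) : ℕ) : ℝ) + 1) := by
      exact_mod_cast hcard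
    have c2 : ((N / (8 * k ^ 2 * T.h m) : ℕ) : ℝ) ≤ N / (8 * (k : ℝ) ^ 2 * T.h m) := by
      refine Nat.cast_div_le.trans (le_of_eq ?_)
      push_cast
      rfl
    have hh' : (0 : ℝ) < T.h m := by exact_mod_cast hh
    have hk' : (0 : ℝ) < (k : ℝ) ^ 2 := by exact_mod_cast hk2
    have c3 : (T.h m : ℝ) ≤ N / (4 * (k : ℝ) ^ 2) := by
      rw [le_div_iff₀ (by positivity)]
      have : (4 * (k : ℝ) ^ 2 * T.h m) ≤ N := by exact_mod_cast hN
      linarith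
    calc (A.card : ℝ) ≤ T.h m * (2 * (N / (8 * (k : ℝ) ^ 2 * T.h m)) + 1) := by
          refine c1.trans ?_
          gcongr
      _ = N / (4 * (k : ℝ) ^ 2) + T.h m := by field_simp; ring
      _ ≤ N / (4 * (k : ℝ) ^ 2) + N / (4 * (k : ℝ) ^ 2) := by gcongr
      _ = _ := by field_simp; ring

/-! ### Comparison of scales -/

/-- Here `k` is at most `log₂ x`, so the bound is uniform in `k`. It follows from `log x ≤ x^(c/2) /
8`, which gives `8 k² ≤ x^c / 2`, together with `x^c > 2`. -/
theorem exists_forall_sq_lt_rpow {c : ℝ} (hc : 0 < c) :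
    ∃ X : ℝ, 2 ≤ X ∧ ∀ x ≥ X, ∀ k : ℕ, (2 : ℝ) ^ k ≤ x → 8 * (k : ℝ) ^ 2 + 1 < x ^ c := by
  have h1 := (isLittleO_log_rpow_atTop (half_pos hc)).bound (show (0 : ℝ) < 1 / 8 by norm_num)
  have h2 := (tendsto_rpow_atTop hc).eventually_gt_atTop 2
  obtain ⟨X, hX⟩ := Filter.eventually_atTop.1 (h1.and h2)
  refine ⟨max X 2, le_max_right _ _, fun x hx k hk => ?_⟩
  obtain ⟨b1, b2⟩ := hX x ((le_max_left _ _).trans hx)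
  have hx2 : 2 ≤ x := (le_max_right _ _).trans hx
  have hlog : 0 ≤ Real.log x := Real.log_nonneg (by linarith)
  have hp : 0 ≤ x ^ (c / 2) := Real.rpow_nonneg (by linarith) _
  rw [Real.norm_of_nonneg hlog, Real.norm_of_nonneg hp] at b1
  have hkl : (k : ℝ) * Real.log 2 ≤ Real.log x := by
    rw [← Real.log_pow]
    exact Real.log_le_log (by positivity) hk
  have hl2 := Real.log_two_gt_d9
  have hk0 : (0 : ℝ) ≤ k := k.cast_nonneg
  have hk2 : (k : ℝ) ≤ x ^ (c / 2) / 4 := by nlinarith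
  have e : x ^ c = x ^ (c / 2) * x ^ (c / 2) := by
    rw [← Real.rpow_add (by linarith), add_halves]
  rw [e] at b2 ⊢
  nlinarith

namespace RankOne

variable (G : RankOne)

theorem exists_forall_le_h (X : ℝ) : ∃ M, ∀ n ≥ M, X ≤ G.h n := by
  obtain ⟨M, hM⟩ := exists_nat_ge X
  refine ⟨M + 1, fun n hn => hM.trans ?_⟩
  exact_mod_cast (G.lt_h_succ M).le.trans (G.h_mono hn)

theorem sq_le_h {n : ℕ} (hn : 7 ≤ n) : n ^ 2 ≤ G.h n := by
  have : n ^ 2 ≤ 2 ^ (n - 1) := by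
    induction n, hn using Nat.le_induction with
    | base => norm_num
    | succ n hn ih =>
      rw [Nat.add_sub_cancel]
      have : 2 ^ n = 2 * 2 ^ (n - 1) := by rw [← pow_succ']; congr 1; omega
      rw [this]
      nlinarith
  refine this.trans ?_
  have := G.two_pow_le_h (n - 1)
  rwa [Nat.sub_add_cancel (by omega)] at this

/-- A number `k` with `2^k < h_m` is logarithmic in `h_m`. So `8 k² + 1` is absorbed both by the gap
between `h_m^γ'` and `h_m` and by the removed columns. -/
theorem exists_spacers_small {γ γ' : ℝ} (hγ : 0 < γ) (hγ' : γ' < 1) (hG : G.MemC γ γ') :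
    ∃ M, ∀ m ≥ M, (∀ i, 2 ≤ i → i ≤ G.p m → G.a m (i - 1) < G.a m i) ∧
      ∀ k : ℕ, 2 ^ k < G.h m → (8 * k ^ 2 + 1) * G.a m (G.p m) < G.h m ∧
        ((8 * k ^ 2 + 1 : ℕ) : ℝ) ≤ (G.h m : ℝ) ^ (γ / 4) := by
  obtain ⟨n', hn', hC⟩ := hG
  obtain ⟨X₁, -, h₁⟩ := exists_forall_sq_lt_rpow (show 0 < γ / 4 by linarith)
  obtain ⟨X₂, -, h₂⟩ := exists_forall_sq_lt_rpow (show 0 < 1 - γ' by linarith)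
  obtain ⟨M, hM⟩ := G.exists_forall_le_h (max X₁ X₂)
  refine ⟨max M n', fun m hm => ?_⟩
  obtain ⟨-, -, c1, c2⟩ := hC m (by omega)
  have hx := hM m (by omega)
  refine ⟨c1, fun k hk => ?_⟩
  have hk' : (2 : ℝ) ^ k ≤ G.h m := by exact_mod_cast hk.le
  have hh : (0 : ℝ) < G.h m := by exact_mod_cast G.h_pos m
  constructor
  · have b := h₂ _ ((le_max_right _ _).trans hx) k hk'
    have : ((8 * (k : ℝ) ^ 2 + 1) * G.a m (G.p m)) < G.h m := by
      calc _ ≤ (8 * (k : ℝ) ^ 2 + 1) * (G.h m : ℝ) ^ γ' := by gcongr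
        _ < (G.h m : ℝ) ^ (1 - γ') * (G.h m : ℝ) ^ γ' := by gcongr
        _ = G.h m := by rw [← Real.rpow_add hh, sub_add_cancel, Real.rpow_one]
    exact_mod_cast this
  · have b := h₁ _ ((le_max_left _ _).trans hx) k hk'
    push_cast
    exact b.le

theorem exists_scale_separation {δ : ℝ} (hδ : 0 < δ) :
    ∃ M, ∀ n ≥ M, ∀ k h : ℕ, 2 ^ k < h → (h : ℝ) ^ (1 + δ) < G.h n →
      8 * k ^ 2 * h ≤ G.h n / n ^ 2 := by
  -- Chosen so that `1/(1+δ) + 3c = 1`. One factor `H^c` absorbs `8 k²` and two absorb `n²`, which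
  -- is logarithmic squared because `2^(n-1) ≤ h_n`.
  set c : ℝ := δ / (3 * (1 + δ)) with hc
  have hcpos : 0 < c := by positivity
  obtain ⟨X, hX2, hX⟩ := exists_forall_sq_lt_rpow hcpos
  obtain ⟨M, hM⟩ := G.exists_forall_le_h X
  refine ⟨max M 1, fun n hn k h hk hh => ?_⟩
  have hHX := hM n (by omega)
  have hn1 : 1 ≤ n := by omega
  set H : ℝ := (G.h n : ℝ) with hH
  have hH2 : 2 ≤ H := hX2.trans hHX
  have hH0 : 0 < H := by linarith
  have hh1 : (1 : ℝ) ≤ h := by exact_mod_cast (Nat.one_le_two_pow (n := k)).trans hk.le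
  have hhH : (h : ℝ) ≤ H := by
    refine le_trans ?_ hh.le
    conv_lhs => rw [← Real.rpow_one (h : ℝ)]
    exact Real.rpow_le_rpow_of_exponent_le hh1 (by linarith)
  have b1 := hX H hHX k (le_trans (by exact_mod_cast hk.le) hhH)
  have b2 := hX H hHX (n - 1) (by
    have := G.two_pow_le_h (n - 1)
    rw [Nat.sub_add_cancel hn1] at this
    rw [hH]
    exact_mod_cast this)
  have b3 := hX H hHX 1 (by linarith)
  have b4 : (h : ℝ) ≤ H ^ (1 / (1 + δ)) := by
    rw [one_div, Real.le_rpow_inv_iff_of_pos (by positivity) hH0.le (by linarith)]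
    exact hh.le
  set Z := H ^ c with hZ
  rw [Nat.cast_sub hn1] at b2
  have b5 : (n : ℝ) ^ 2 ≤ 2 * Z := by
    push_cast at b2
    nlinarith [sq_nonneg ((n : ℝ) - 2)]
  have b6 : 2 * Z ≤ Z * Z := by push_cast at b3; nlinarith
  have hZ0 : 0 < Z := by positivity
  rw [Nat.le_div_iff_mul_le (by positivity)]
  have : (8 * (k : ℝ) ^ 2 * h * (n : ℝ) ^ 2) ≤ H := by
    calc (8 * (k : ℝ) ^ 2 * h * (n : ℝ) ^ 2) ≤ Z * H ^ (1 / (1 + δ)) * (Z * Z) := by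
          gcongr
          · linarith
          · linarith
      _ = H ^ (c + 1 / (1 + δ) + (c + c)) := by
          rw [Real.rpow_add hH0, Real.rpow_add hH0, Real.rpow_add hH0]
      _ = H := by
          rw [show c + 1 / (1 + δ) + (c + c) = 1 by rw [hc]; field_simp; ring, Real.rpow_one]
  rw [hH] at this
  exact_mod_cast this

/-! ### Matched times in one dyadic range of distances -/

theorem dH_cases {n : ℕ} (hn : 1 ≤ n) {u v : ℝ} (huv : G.SameLevel n u v) :
    (∀ K, ∃ M ≥ K, G.SameLevel M u v) ∧ G.dH u v = 0 ∨
    ∃ M ≥ n, G.dH u v = 1 / G.h M ∧ G.SameLevel M u v ∧ ¬G.SameLevel (M + 1) u v := by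
  by_cases hb : BddAbove {m : ℕ | 1 ≤ m ∧ G.SameLevel m u v}
  · right
    have hne : {m : ℕ | 1 ≤ m ∧ G.SameLevel m u v}.Nonempty := ⟨n, hn, huv⟩
    refine ⟨_, le_csSup hb ⟨hn, huv⟩, by rw [dH, if_pos hb], (Nat.sSup_mem hne hb).2, fun h => ?_⟩
    have := le_csSup hb ⟨by omega, h⟩
    omega
  · left
    refine ⟨fun K => ?_, by rw [dH, if_neg hb]⟩
    by_contra! hK
    exact hb ⟨K, fun m hm => by
      by_contra! h
      exact hK m h.le hm.2⟩

/-- Membership of `u` in the tower excludes the atom `none`, whose points need not share a level. -/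
theorem sameLevel_of_atom_eq {n : ℕ} {u v : ℝ} (hu : u ∈ G.tower n) (h : G.atom n u = G.atom n v) :
    G.SameLevel n u v := by
  classical
  have hu' := G.mem_tower_iff.1 hu
  have hu'' : ∃ j, j < G.h n ∧ u ∈ G.level n j := hu'
  rw [atom, dif_pos hu'', atom] at h
  split_ifs at h with hv
  have e := Option.some.inj h
  refine ⟨Nat.find hu'', (Nat.find_spec hu'').1, (Nat.find_spec hu'').2, ?_⟩
  rw [e]
  exact (Nat.find_spec hv).2

theorem mem_Fset_of_mem_F {γ : ℝ} {n₁ n : ℕ} (hn : n₁ ≤ n) {x : ℝ} (hx : x ∈ G.F γ n₁) :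
    x ∈ G.Fset γ n := mem_iInter₂.1 hx n hn

end RankOne

open RankOne in
/-- The bound for the matched times at which the distance for `T` is in the dyadic interval given
by `k` and dominates the distance for `S`. -/
theorem card_matched_dominant_le {T S : RankOne} {γ δ : ℝ} (hγ : 0 < γ) (hδ : 0 < δ)
    {nT nS n₂ n₀ : ℕ} (hn₂ : 7 ≤ n₂) (hnT : nT ≤ n₂) (hnS : nS ≤ n₂) (hn₀ : n₂ ≤ n₀)
    (hST : S.h n₂ ≤ T.h n₀)
    (hT : ∀ m ≥ n₂, (∀ i, 2 ≤ i → i ≤ T.p m → T.a m (i - 1) < T.a m i) ∧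
      ∀ k : ℕ, 2 ^ k < T.h m → (8 * k ^ 2 + 1) * T.a m (T.p m) < T.h m ∧
        ((8 * k ^ 2 + 1 : ℕ) : ℝ) ≤ (T.h m : ℝ) ^ (γ / 4))
    (hS : ∀ n ≥ n₂, ∀ k h : ℕ, 2 ^ k < h → (h : ℝ) ^ (1 + δ) < S.h n →
      8 * k ^ 2 * h ≤ S.h n / n ^ 2)
    (halt : ∀ m ≥ n₂, ∀ n, 1 ≤ n → S.h n ≤ T.h m → T.h m < S.h (n + 1) →
      (S.h n : ℝ) ^ (1 + δ) < T.h m ∧ (T.h m : ℝ) ^ (1 + δ) < S.h (n + 1))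
    {x y x' y' : ℝ} (hy : y ∈ S.core n₂) (hy' : y' ∈ S.core n₂)
    (hyy' : y' ∉ ⋃ n ∈ Ici n₂, S.nearLevels n y) {k N r : ℕ} (hk : 1 ≤ k)
    {i j : Fin r → Fin N} (hi : StrictMono i) (hj : StrictMono j) (A : Finset (Fin r))
    (hA : ∀ s ∈ A, T.map^[i s] x ∈ T.F γ nT ∧ T.map^[j s] x' ∈ T.F γ nT ∧
      S.map^[i s] y ∈ S.F γ nS ∧
      T.SameLevel n₀ (T.map^[i s] x) (T.map^[j s] x') ∧
      S.SameLevel n₀ (S.map^[i s] y) (S.map^[j s] y') ∧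
      S.dH (S.map^[i s] y) (S.map^[j s] y') ≤ T.dH (T.map^[i s] x) (T.map^[j s] x') ∧
      (2 : ℝ) ^ (-(k : ℤ) - 1) ≤ T.dH (T.map^[i s] x) (T.map^[j s] x') ∧
      T.dH (T.map^[i s] x) (T.map^[j s] x') < (2 : ℝ) ^ (-(k : ℤ))) :
    (A.card : ℝ) ≤ N / (2 * (k : ℝ) ^ 2) := by
  have scale : ∀ s ∈ A, ∃ m ≥ n₀, 2 ^ k < T.h m ∧ T.h m ≤ 2 ^ (k + 1) ∧
      T.dH (T.map^[i s] x) (T.map^[j s] x') = 1 / T.h m ∧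
      T.SameLevel m (T.map^[i s] x) (T.map^[j s] x') ∧
      ¬T.SameLevel (m + 1) (T.map^[i s] x) (T.map^[j s] x') := by
    intro s hs
    obtain ⟨-, -, -, a4, -, -, a7, a8⟩ := hA s hs
    rcases T.dH_cases (by omega) a4 with ⟨-, h0⟩ | ⟨m, hm, e, h1, h2⟩
    · rw [h0] at a7
      exact absurd a7 (not_le.2 (by positivity))
    · have hh : (0 : ℝ) < T.h m := by exact_mod_cast T.h_pos m
      refine ⟨m, hm, ?_, ?_, e, h1, h2⟩
      · rw [e, zpow_neg, zpow_natCast, ← one_div,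
          one_div_lt_one_div hh (by positivity)] at a8
        exact_mod_cast a8
      · rw [e, show (-(k : ℤ) - 1) = -((k + 1 : ℕ) : ℤ) by push_cast; ring, zpow_neg,
          zpow_natCast, ← one_div, one_div_le_one_div (by positivity) hh] at a7
        exact_mod_cast a7
  rcases A.eq_empty_or_nonempty with rfl | ⟨s₀, hs₀⟩
  · rw [Finset.card_empty, Nat.cast_zero]
    positivity
  obtain ⟨m, hm, hm1, hm2, -⟩ := scale s₀ hs₀
  have hex : ∃ n, T.h m < S.h (n + 1) := ⟨T.h m, S.lt_h_succ _⟩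
  classical
  set n := Nat.find hex with hn_def
  have hn1 : T.h m < S.h (n + 1) := Nat.find_spec hex
  -- The starting index `n₀` is so large that `h_m` of `T` already exceeds or equals `h_{n₂}` of
  -- `S`; hence tower `n + 1` is late enough for all estimates.
  have hn2 : n₂ < n + 1 := by
    by_contra! h
    have h1 := S.h_mono h
    have h2 := T.h_mono hm
    omega
  have hn3 : S.h n ≤ T.h m := by
    have := Nat.find_min hex (show n - 1 < n by omega)
    rw [Nat.sub_add_cancel (by omega)] at this
    omega
  obtain ⟨al1, al2⟩ := halt m (by omega) n (by omega) hn3 hn1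
  have hn4 : S.h n < T.h m := by
    have h1 : (1 : ℝ) ≤ S.h n := by exact_mod_cast S.h_pos n
    have h2 : (S.h n : ℝ) ≤ (S.h n : ℝ) ^ (1 + δ) := by
      conv_lhs => rw [← Real.rpow_one (S.h n : ℝ)]
      exact Real.rpow_le_rpow_of_exponent_le h1 (by linarith)
    exact_mod_cast h2.trans_lt al1
  obtain ⟨t1, t2⟩ := hT m (by omega)
  obtain ⟨t3, t4⟩ := t2 k hm1
  obtain ⟨l, hl, hlq, hyl⟩ := S.exists_of_mem_core (by omega) (show n₂ ≤ n + 1 by omega) hy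
  obtain ⟨l', hl', hlq', hyl'⟩ := S.exists_of_mem_core (by omega) (show n₂ ≤ n + 1 by omega) hy'
  have hTm : m ^ 2 ≤ T.h m := T.sq_le_h (by omega)
  have hSn : (n + 1) ^ 2 ≤ S.h (n + 1) := S.sq_le_h (by omega)
  refine card_matched_le hγ hi hj hk (by omega) hTm (show 1 ≤ n + 1 by omega) hSn t1 t3 t4
    (hS (n + 1) (by omega) k _ hm1 al2) (x := x) (x' := x') (y := y) (y' := y') A
    (fun s hs => ?_) hlq hlq' hyl hyl' fun hnear => hyy' ?_
  · obtain ⟨a1, a2, a3, a4, a5, a6, -, -⟩ := hA s hs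
    obtain ⟨m', hm', hm1', hm2', e, e1, e2⟩ := scale s hs
    -- Heights at least double, so at most one lies in `(2^k, 2^(k+1)]`.
    have hmm : m' = m := by
      rcases lt_trichotomy m' m with h | h | h
      · have h1 := T.h_mono (show m' + 1 ≤ m from h)
        have h2 := T.two_mul_h_le (show 1 ≤ m' by omega)
        rw [pow_succ] at hm2
        omega
      · exact h
      · have h1 := T.h_mono (show m + 1 ≤ m' from h)
        have h2 := T.two_mul_h_le (show 1 ≤ m by omega)
        rw [pow_succ] at hm2'
        omega
    subst hmm
    have hyF := S.mem_Fset_of_mem_F (show nS ≤ n + 1 by omega) a3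
    have hyt : S.map^[i s] y ∈ S.tower (n + 1) := by
      obtain ⟨ρ, -, hρ, -, -, hyρ, -⟩ := S.exists_of_mem_Fset hγ (by omega) hSn hyF
      exact S.mem_tower_iff.2 ⟨ρ, hρ, hyρ⟩
    refine ⟨T.mem_Fset_of_mem_F (by omega) a1, T.mem_Fset_of_mem_F (by omega) a2, e1, e2, hyF, ?_⟩
    rcases S.dH_cases (by omega) a5 with ⟨hall, -⟩ | ⟨M, -, eM, hM, -⟩
    · obtain ⟨M, hM, hsM⟩ := hall (n + 1)
      exact S.sameLevel_of_le (by omega) hM hyt hsM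
    · refine S.sameLevel_of_le (by omega) ?_ hyt hM
      rw [e, eM, one_div_le_one_div (by exact_mod_cast S.h_pos M)
        (by exact_mod_cast T.h_pos _)] at a6
      have a6' : T.h m' ≤ S.h M := by exact_mod_cast a6
      by_contra! h
      have := S.h_mono (show M ≤ n by omega)
      omega
  · refine mem_iUnion₂.2 ⟨n + 1, by simp only [mem_Ici]; omega, mem_iUnion₂.2 ⟨l', ?_, hyl'⟩⟩
    simp only [Finset.mem_filter, Finset.mem_range]
    exact ⟨hl', l, hl, hyl, hnear⟩

/-! ### Choice of the sets and conclusion -/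

/-- Sets of points whose orbits mostly stay in `F` and which avoid the extreme levels of all later
towers, as well as the levels close to those of a given point. -/
theorem RankOne.exists_good_points (G : RankOne) {γ : ℝ} {n₁ : ℕ} (hn₁ : G.Admissible γ n₁) :
    ∃ M, ∀ n₂ ≥ M, ∀ n₀ ≥ n₂, ∃ B : Set ℝ, MeasurableSet B ∧ B ⊆ G.space ∧ B ⊆ G.core n₂ ∧
      (∀ x ∈ B, ∀ N : ℕ, ({i : ℕ | i < N ∧
        G.map^[i] x ∈ (G.F γ n₁ ∩ G.tower n₀)ᶜ}.ncard : ℝ) ≤ (1 / 20) * N) ∧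
      999 / 1000 ≤ G.μ.real B ∧
      ∀ x, 999 / 1000 ≤ G.μ.real (B \ ⋃ n ∈ Ici n₂, G.nearLevels n x) := by
  obtain ⟨N₁, h₁⟩ := G.exists_μ_real_compl_core_le (show (0 : ℝ) < 1 / 100000 by norm_num)
  obtain ⟨N₂, h₂⟩ := Filter.eventually_atTop.1
    (G.tendsto_μ_real_compl_tower.eventually (gt_mem_nhds (show (0 : ℝ) < 1 / 100000 by norm_num)))
  refine ⟨max N₁ N₂, fun n₂ hn₂ n₀ hn₀ => ?_⟩
  obtain ⟨hc, hnear⟩ := h₁ n₂ (by omega)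
  have ht := h₂ n₀ (by omega)
  obtain ⟨hn₁1, hF⟩ := hn₁
  have hFm := G.measurableSet_F γ hn₁1
  have hE : MeasurableSet (G.F γ n₁ ∩ G.tower n₀)ᶜ := (hFm.inter (G.measurableSet_tower _)).compl
  have hEμ : G.μ.real (G.F γ n₁ ∩ G.tower n₀)ᶜ ≤ 2 / 100000 := by
    rw [compl_inter]
    refine (measureReal_union_le _ _).trans ?_
    rw [probReal_compl_eq_one_sub hFm]
    norm_num at hF
    linarith
  -- Each of the two coordinates may spend a twentieth of the time outside, which together is the
  -- tenth allowed by (P1). The loss in measure is at most `20 · 2 / 100000`.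
  obtain ⟨A, hAm, hAμ, hA⟩ := exists_card_visits_le G.measurePreserving_map hE
    (show (0 : ℝ) < 1 / 20 by norm_num)
  have hBm : MeasurableSet (A ∩ G.core n₂ ∩ G.space) :=
    (hAm.inter (G.measurableSet_core _)).inter G.measurableSet_space
  have hBc : G.μ.real (A ∩ G.core n₂ ∩ G.space)ᶜ ≤ 41 / 100000 := by
    rw [compl_inter, compl_inter]
    refine (measureReal_union_le _ _).trans ?_
    rw [G.μ_real_compl_space]
    have := measureReal_union_le (μ := G.μ) Aᶜ (G.core n₂)ᶜ
    have h3 : G.μ.real (G.F γ n₁ ∩ G.tower n₀)ᶜ / (1 / 20) ≤ 40 / 100000 := by linarith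
    linarith
  rw [probReal_compl_eq_one_sub hBm] at hBc
  refine ⟨A ∩ G.core n₂ ∩ G.space, hBm, inter_subset_right, fun x hx => hx.1.2,
    fun x hx N => hA x hx.1.1 N, by linarith, fun x => ?_⟩
  have := measureReal_mono (μ := G.μ)
    (subset_sdiff_union (A ∩ G.core n₂ ∩ G.space) (⋃ n ∈ Ici n₂, G.nearLevels n x))
  have h4 := measureReal_union_le (μ := G.μ)
    ((A ∩ G.core n₂ ∩ G.space) \ ⋃ n ∈ Ici n₂, G.nearLevels n x)
    (⋃ n ∈ Ici n₂, G.nearLevels n x)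
  have h5 := hnear x
  linarith

theorem RankOne.measurableSet_biUnion_nearLevels (G : RankOne) (n₂ : ℕ) (x : ℝ) :
    MeasurableSet (⋃ n ∈ Ici n₂, G.nearLevels n x) :=
  MeasurableSet.biUnion (to_countable _) fun _ _ => G.measurableSet_nearLevels _ _

/-- Two orbits that each leave a set with frequency at most `1 / 20` are simultaneously in these
sets with frequency at least `9 / 10`. -/
theorem le_ncard_visits {f g : ℕ → ℝ} {U V : Set ℝ} {N : ℕ}
    (hf : ({i : ℕ | i < N + 1 ∧ f i ∈ Uᶜ}.ncard : ℝ) ≤ (1 / 20) * (N + 1 : ℕ))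
    (hg : ({i : ℕ | i < N + 1 ∧ g i ∈ Vᶜ}.ncard : ℝ) ≤ (1 / 20) * (N + 1 : ℕ)) :
    9 / 10 * (N : ℝ) ≤ ({i : ℕ | i ≤ N ∧ (f i, g i) ∈ U ×ˢ V}.ncard : ℝ) := by
  have hsub : Iio (N + 1) ⊆ {i : ℕ | i ≤ N ∧ (f i, g i) ∈ U ×ˢ V} ∪
      ({i : ℕ | i < N + 1 ∧ f i ∈ Uᶜ} ∪ {i : ℕ | i < N + 1 ∧ g i ∈ Vᶜ}) := by
    intro i hi
    rw [mem_Iio] at hi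
    by_cases hU : f i ∈ U
    · by_cases hV : g i ∈ V
      · exact Or.inl ⟨by omega, hU, hV⟩
      · exact Or.inr (Or.inr ⟨hi, hV⟩)
    · exact Or.inr (Or.inl ⟨hi, hU⟩)
  have hfin : ({i : ℕ | i ≤ N ∧ (f i, g i) ∈ U ×ˢ V} ∪
      ({i : ℕ | i < N + 1 ∧ f i ∈ Uᶜ} ∪ {i : ℕ | i < N + 1 ∧ g i ∈ Vᶜ})).Finite :=
    ((finite_Iic N).subset fun i hi => hi.1).union
      (((finite_Iio (N + 1)).subset fun i hi => hi.1).union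
        ((finite_Iio (N + 1)).subset fun i hi => hi.1))
  have h1 := (ncard_le_ncard hsub hfin).trans ((ncard_union_le _ _).trans
    (Nat.add_le_add_left (ncard_union_le _ _) _))
  rw [← Finset.coe_Iio, ncard_coe_finset, Nat.card_Iio] at h1
  have h2 : ((N + 1 : ℕ) : ℝ) ≤ ({i : ℕ | i ≤ N ∧ (f i, g i) ∈ U ×ˢ V}.ncard : ℝ) +
      (({i : ℕ | i < N + 1 ∧ f i ∈ Uᶜ}.ncard : ℝ) +
        ({i : ℕ | i < N + 1 ∧ g i ∈ Vᶜ}.ncard : ℝ)) := by exact_mod_cast h1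
  push_cast at hf hg h2
  linarith

theorem le_real_prod {μ ν : Measure ℝ} [IsProbabilityMeasure μ] [IsProbabilityMeasure ν]
    {B C : Set ℝ} (hB : 999 / 1000 ≤ μ.real B) (hC : 999 / 1000 ≤ ν.real C) :
    99 / 100 ≤ (μ.prod ν).real (B ×ˢ C) := by
  rw [measureReal_prod_prod]
  nlinarith

theorem proposition4p1 (γ γ' δ : ℝ) (hδ : 0 < δ) (hδγ : δ < γ) (hγ : γ < γ') (hγ' : γ' < 1)
    (T S : RankOne) (hTS : MemL γ γ' δ T S) :
    (∃ nT, T.Admissible γ nT) ∧ (∃ nS, S.Admissible γ nS) ∧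
    ∀ nT nS : ℕ, T.Admissible γ nT → S.Admissible γ nS →
      ∃ n₀ ≥ 100, ∃ N₀ : ℕ, ∃ B C : Set ℝ,
        MeasurableSet B ∧ MeasurableSet C ∧ B ⊆ T.space ∧ C ⊆ S.space ∧
        99 / 100 ≤ (T.μ.prod S.μ).real (B ×ˢ C) ∧
        ∃ D E : ℝ → Set ℝ, ∀ x ∈ B, ∀ y ∈ C,
          MeasurableSet (D x) ∧ MeasurableSet (E y) ∧ D x ⊆ T.space ∧ E y ⊆ S.space ∧
          99 / 100 ≤ (T.μ.prod S.μ).real (D x ×ˢ E y) ∧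
          ∀ x' ∈ D x, ∀ y' ∈ E y, ∀ N ≥ N₀,
            (∀ z ∈ ({(x, y), (x', y')} : Set (ℝ × ℝ)),
              9 / 10 * (N : ℝ) ≤
                ({i : ℕ | i ≤ N ∧
                  (T.map^[i] z.1, S.map^[i] z.2) ∈ goodSet T S γ nT nS n₀}.ncard : ℝ)) ∧
            (∀ k : ℕ, 1 ≤ k →
              ∀ θ : Matching (pname T S n₀ N (x, y)) (pname T S n₀ N (x', y')),
                ((matchedAtScale T S γ nT nS n₀ (x, y) (x', y') θ k).ncard : ℝ)
                  ≤ (N : ℝ) / (k : ℝ) ^ 2) := by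
  have hγ0 : 0 < γ := hδ.trans hδγ
  obtain ⟨hTC, hSC, ⟨a₁, -, hTa⟩, ⟨a₂, -, hSa⟩⟩ := hTS
  refine ⟨T.exists_admissible hγ0 hTC, S.exists_admissible hγ0 hSC, fun nT nS hnT hnS => ?_⟩
  obtain ⟨M₁, h₁⟩ := T.exists_spacers_small hγ0 hγ' hTC
  obtain ⟨M₂, h₂⟩ := S.exists_spacers_small hγ0 hγ' hSC
  obtain ⟨M₃, h₃⟩ := T.exists_scale_separation hδ
  obtain ⟨M₄, h₄⟩ := S.exists_scale_separation hδ
  obtain ⟨M₅, h₅⟩ := T.exists_good_points hnT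
  obtain ⟨M₆, h₆⟩ := S.exists_good_points hnS
  obtain ⟨n₂, hn₂⟩ : ∃ n₂, n₂ = a₁ + a₂ + nT + nS + M₁ + M₂ + M₃ + M₄ + M₅ + M₆ + 7 := ⟨_, rfl⟩
  -- The index exceeds both heights at stage `n₂`, and heights dominate indices. Thus the heights at
  -- stage `n₀` of each map exceed those at stage `n₂` of the other.
  obtain ⟨n₀, hn₀⟩ : ∃ n₀, n₀ = 100 + n₂ + S.h n₂ + T.h n₂ := ⟨_, rfl⟩
  have hST : S.h n₂ ≤ T.h n₀ := by
    have := T.lt_h_succ (n₀ - 1)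
    rw [Nat.sub_add_cancel (by omega)] at this
    omega
  have hTS : T.h n₂ ≤ S.h n₀ := by
    have := S.lt_h_succ (n₀ - 1)
    rw [Nat.sub_add_cancel (by omega)] at this
    omega
  obtain ⟨B, hBm, hBs, hBc, hBv, hBμ, hD⟩ := h₅ n₂ (by omega) n₀ (by omega)
  obtain ⟨C, hCm, hCs, hCc, hCv, hCμ, hE⟩ := h₆ n₂ (by omega) n₀ (by omega)
  refine ⟨n₀, by omega, 0, B, C, hBm, hCm, hBs, hCs, le_real_prod hBμ hCμ,
    fun x => B \ ⋃ n ∈ Ici n₂, T.nearLevels n x, fun y => C \ ⋃ n ∈ Ici n₂, S.nearLevels n y,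
    fun x hx y hy => ⟨hBm.diff (T.measurableSet_biUnion_nearLevels _ _),
      hCm.diff (S.measurableSet_biUnion_nearLevels _ _), sdiff_subset.trans hBs,
      sdiff_subset.trans hCs, le_real_prod (hD x) (hE y), fun x' hx' y' hy' N _ => ⟨?_, ?_⟩⟩⟩
  · rintro z (rfl | rfl)
    · exact le_ncard_visits (f := fun i => T.map^[i] x) (g := fun i => S.map^[i] y)
        (hBv x hx _) (hCv y hy _)
    · exact le_ncard_visits (f := fun i => T.map^[i] x') (g := fun i => S.map^[i] y')
        (hBv x' hx'.1 _) (hCv y' hy'.1 _)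
  · intro k hk θ
    classical
    have hmem : ∀ s ∈ matchedAtScale T S γ nT nS n₀ (x, y) (x', y') θ k,
        T.SameLevel n₀ (T.map^[θ.i s] x) (T.map^[θ.j s] x') ∧
        S.SameLevel n₀ (S.map^[θ.i s] y) (S.map^[θ.j s] y') := by
      rintro s ⟨hs, -⟩
      have e := θ.eq s
      simp only [pname, Prod.mk.injEq] at e
      exact ⟨T.sameLevel_of_atom_eq hs.1.2 e.1, S.sameLevel_of_atom_eq hs.2.2 e.2⟩
    -- The maximum of the two distances is attained by one of them. Ties lie in both sets, which is
    -- harmless for an upper bound, and each set contributes `N / (2 k²)`.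
    set AT : Finset (Fin θ.r) := Finset.univ.filter fun s =>
      s ∈ matchedAtScale T S γ nT nS n₀ (x, y) (x', y') θ k ∧
        S.dH (S.map^[θ.i s] y) (S.map^[θ.j s] y') ≤ T.dH (T.map^[θ.i s] x) (T.map^[θ.j s] x')
      with hAT
    set AS : Finset (Fin θ.r) := Finset.univ.filter fun s =>
      s ∈ matchedAtScale T S γ nT nS n₀ (x, y) (x', y') θ k ∧
        T.dH (T.map^[θ.i s] x) (T.map^[θ.j s] x') ≤ S.dH (S.map^[θ.i s] y) (S.map^[θ.j s] y')
      with hAS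
    have hcover : matchedAtScale T S γ nT nS n₀ (x, y) (x', y') θ k ⊆ ((AT ∪ AS : Finset _) :
        Set (Fin θ.r)) := by
      intro s hs
      simp only [Finset.coe_union, mem_union, Finset.mem_coe, hAT, hAS, Finset.mem_filter,
        Finset.mem_univ, true_and, hs]
      exact le_total _ _
    have bT : (AT.card : ℝ) ≤ N / (2 * (k : ℝ) ^ 2) := by
      refine card_matched_dominant_le hγ0 hδ (n₂ := n₂) (n₀ := n₀) (by omega)
        (show nT ≤ n₂ by omega) (show nS ≤ n₂ by omega) (by omega) hST
        (fun m hm => h₁ m (by omega)) (fun n hn => h₄ n (by omega))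
        (fun m hm n hn => hSa m (by omega) n hn) (x := x) (x' := x') (hCc hy) (hCc hy'.1) hy'.2 hk
        θ.strictMono_i θ.strictMono_j AT fun s hs => ?_
      obtain ⟨hs, hle⟩ := (Finset.mem_filter.1 hs).2
      obtain ⟨e1, e2⟩ := hmem s hs
      obtain ⟨g1, g2, g3, g4⟩ := hs
      simp only at g3 g4
      rw [max_eq_left hle] at g3 g4
      exact ⟨g1.1.1, g2.1.1, g1.2.1, e1, e2, hle, g3, g4⟩
    have bS : (AS.card : ℝ) ≤ N / (2 * (k : ℝ) ^ 2) := by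
      refine card_matched_dominant_le hγ0 hδ (n₂ := n₂) (n₀ := n₀) (by omega)
        (show nS ≤ n₂ by omega) (show nT ≤ n₂ by omega) (by omega) hTS
        (fun m hm => h₂ m (by omega)) (fun n hn => h₃ n (by omega))
        (fun m hm n hn => hTa m (by omega) n hn) (x := y) (x' := y') (hBc hx) (hBc hx'.1) hx'.2 hk
        θ.strictMono_i θ.strictMono_j AS fun s hs => ?_
      obtain ⟨hs, hle⟩ := (Finset.mem_filter.1 hs).2
      obtain ⟨e1, e2⟩ := hmem s hs
      obtain ⟨g1, g2, g3, g4⟩ := hs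
      simp only at g3 g4
      rw [max_eq_right hle] at g3 g4
      exact ⟨g1.2.1, g2.2.1, g1.1.1, e2, e1, hle, g3, g4⟩
    have hcard : (matchedAtScale T S γ nT nS n₀ (x, y) (x', y') θ k).ncard ≤
        AT.card + AS.card := by
      refine (ncard_le_ncard hcover (Finset.finite_toSet _)).trans ?_
      rw [ncard_coe_finset]
      exact Finset.card_union_le _ _
    have hcard' : ((matchedAtScale T S γ nT nS n₀ (x, y) (x', y') θ k).ncard : ℝ) ≤
        AT.card + AS.card := by exact_mod_cast hcard
    calc _ ≤ (N : ℝ) / (2 * (k : ℝ) ^ 2) + N / (2 * (k : ℝ) ^ 2) := by linarith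
      _ = _ := by
        have : (k : ℝ) ≠ 0 := by positivity
        field_simp
        ring
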